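/- All matroids are finite. For matroids $M$ and $N$ with $|E(M)|\ge 2$, call $M$ *$N$-connected* if, for every two distinct elements $e,f\in E(M)$, there is a minor of $M$ that is isomorphic to $N$ and whose ground set contains $\{e,f\}$. Say that $N$ has the *inductive property* if, for every $N$-connected matroid $M$ with $|E(M)|>|E(N)|$ and every $e\in E(M)$, at least one of $M\backslash e$ and $M/e$ is $N$-connected. **Theorem.** Let $N$ be a matroid with $|E(N)|\ge 2$. If $N$ has the inductive property, then $N$ is isomorphic to one of $U_{1,2}$, $U_{0,2}$ or $U_{2,2}$. Moreover, if $N$ is connected (every two distinct elements of $N$ lie in a common circuit), then $N$ has the inductive property if and only if $N\cong U_{1,2}$. Here $U_{r,n}$ is the uniform matroid of rank $r$ on $n$ elements. -/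

import Mathlib

open Set

namespace Matroid

universe u v

/-- Two matroids are isomorphic if some bijection between their ground sets preserves
independence in both directions. -/
def Isomorphic {α : Type u} {β : Type v} (M : Matroid α) (N : Matroid β) : Prop :=
  ∃ φ : M.E ≃ N.E, ∀ I : Set M.E,
    M.Indep (Subtype.val '' I) ↔ N.Indep (Subtype.val '' (φ '' I))

/-- The uniform matroid `U_{r,n}` on the ground set `Fin n`: the independent sets are the sets
with at most `r` elements. -/
def uniform (r n : ℕ) : Matroid (Fin n) :=
  (IndepMatroid.ofFinite (E := (univ : Set (Fin n))) finite_univ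
    (fun I => I.ncard ≤ r)
    (by simp)
    (fun _ J hJ hIJ => (ncard_le_ncard hIJ (toFinite J)).trans hJ)
    (fun I J _ hJ hlt => by
      obtain ⟨e, heJ, heI⟩ := exists_mem_notMem_of_ncard_lt_ncard hlt (toFinite I)
      refine ⟨e, heJ, heI, ?_⟩
      rw [ncard_insert_of_notMem heI (toFinite I)]
      omega)
    (fun I _ => subset_univ I)).matroid

/-- A matroid is connected if every two distinct elements lie in a common circuit. -/
def IsConnected {α : Type u} (M : Matroid α) : Prop :=
  ∀ e ∈ M.E, ∀ f ∈ M.E, e ≠ f → ∃ C, M.IsCircuit C ∧ e ∈ C ∧ f ∈ C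

/-- `M` is `N`-connected: `M` has at least two elements, and every two distinct elements of `M`
are contained in the ground set of a common minor of `M` that is isomorphic to `N`. -/
def MinorConnected {α : Type u} {β : Type v} (N : Matroid α) (M : Matroid β) : Prop :=
  M.E.Nontrivial ∧
    ∀ e ∈ M.E, ∀ f ∈ M.E, e ≠ f →
      ∃ M' : Matroid β, M' ≤m M ∧ M'.Isomorphic N ∧ e ∈ M'.E ∧ f ∈ M'.E

/-- For every `N`-connected (finite) matroid `M` with more elements than `N` and every element `e`
of `M`, at least one of `M ＼ e` and `M ／ e` is `N`-connected. Since `M` is finite, the universe in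
which its elements live is immaterial. -/
def InductiveProperty {α : Type u} (N : Matroid α) : Prop :=
  ∀ (β : Type u) (M : Matroid β), M.Finite → N.MinorConnected M → N.E.ncard < M.E.ncard →
    ∀ e ∈ M.E, N.MinorConnected (M ＼ {e}) ∨ N.MinorConnected (M ／ {e})

end Matroid

namespace Matroid

universe u v w

/-! ### Isomorphism of matroids. -/

section Isomorphism

variable {α : Type u} {β : Type v} {γ : Type w} {M : Matroid α} {N : Matroid β}

/-! Let n = |E(N)|. The engine is `InductiveProperty.exists_minor`: if N has the inductive property
and M is N-connected, then removing the elements outside X one at a time shows that every n-element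
subset X of E(M) carries an N-minor. An N-connected M with a degenerate X therefore restricts N.

Given a circuit of N through distinct p and q, glue n copies of the component of p in parallel at p,
and delete p. With X the set of copies of q, this forces the circuit to be {p, q}
(`InductiveProperty.isCircuit_eq_pair`). Now p and q are parallel; replacing p by n parallel copies,
and taking these as X, forces N to be loopless of rank one (`InductiveProperty.not_indep_pair`). The
property is self-dual, and for n ≥ 3 a loopless rank-one matroid and its dual cannot both be of this
kind, so every circuit is a loop. Thus N consists of loops and coloops. Two loops would make every
element a loop, again by replacing p by copies, and that is refuted by n parallel elements plus a
loop (`InductiveProperty.exists_indep_singleton`). Dually there is at most one coloop, so n ≤ 2.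
When n = 2, the one unwanted case, a loop plus a coloop, is refuted by the rank-three whirl
(`InductiveProperty.isLoop_of_isLoop`).

Conversely, being U_{1,2}-connected is the same as being connected, and deletion or contraction of
an element preserves connectedness. -/

lemma isomorphic_of_bijOn (f : α → β) (hf : BijOn f M.E N.E)
    (h : ∀ I ⊆ M.E, M.Indep I ↔ N.Indep (f '' I)) : M.Isomorphic N := by
  refine ⟨hf.equiv f, fun I ↦ ?_⟩
  rw [h _ (by simp)]
  have : f '' (Subtype.val '' I) = Subtype.val '' ((hf.equiv f) '' I) := by
    rw [image_image, image_image]; rfl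
  rw [this]

lemma Isomorphic.exists_bijOn (h : M.Isomorphic N) (hne : M.E.Nonempty) :
    ∃ f : α → β, BijOn f M.E N.E ∧ ∀ I ⊆ M.E, M.Indep I ↔ N.Indep (f '' I) := by
  classical
  obtain ⟨φ, hφ⟩ := h
  obtain ⟨a, ha⟩ := hne
  set f : α → β := fun x ↦ if hx : x ∈ M.E then (φ ⟨x, hx⟩).1 else (φ ⟨a, ha⟩).1 with hf
  have hfv : ∀ x : M.E, f x = φ x := by
    rintro ⟨x, hx⟩
    simp [hf, hx]
  refine ⟨f, ⟨fun x hx ↦ ?_, fun x hx y hy hxy ↦ ?_, fun y hy ↦ ?_⟩, fun I hI ↦ ?_⟩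
  · rw [hfv ⟨x, hx⟩]; exact (φ _).2
  · rw [hfv ⟨x, hx⟩, hfv ⟨y, hy⟩] at hxy
    exact congrArg Subtype.val (φ.injective (Subtype.ext hxy))
  · refine ⟨φ.symm ⟨y, hy⟩, (φ.symm ⟨y, hy⟩).2, ?_⟩
    rw [hfv]; simp
  · have h1 := hφ (Subtype.val ⁻¹' I)
    rw [Subtype.image_preimage_coe, inter_eq_self_of_subset_right hI] at h1
    rw [h1]
    have : Subtype.val '' (φ '' (Subtype.val ⁻¹' I)) = f '' I := by
      ext y
      constructor
      · rintro ⟨_, ⟨x, hx, rfl⟩, rfl⟩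
        exact ⟨x, hx, hfv x⟩
      · rintro ⟨x, hx, rfl⟩
        exact ⟨_, ⟨⟨x, hI hx⟩, hx, rfl⟩, (hfv ⟨x, hI hx⟩).symm⟩
    rw [this]

lemma Isomorphic.symm (h : M.Isomorphic N) : N.Isomorphic M := by
  obtain ⟨φ, hφ⟩ := h
  refine ⟨φ.symm, fun I ↦ ?_⟩
  rw [hφ, ← image_comp φ, Equiv.self_comp_symm, image_id]

lemma Isomorphic.trans {P : Matroid γ} (h : M.Isomorphic N) (h' : N.Isomorphic P) :
    M.Isomorphic P := by
  obtain ⟨φ, hφ⟩ := h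
  obtain ⟨ψ, hψ⟩ := h'
  refine ⟨φ.trans ψ, fun I ↦ ?_⟩
  rw [hφ, hψ, ← image_comp ψ]
  rfl

lemma Isomorphic.ncard_eq (h : M.Isomorphic N) : M.E.ncard = N.E.ncard := by
  obtain ⟨φ, -⟩ := h
  exact Nat.card_congr φ

lemma isomorphic_map (M : Matroid α) (f : α → β) (hf : InjOn f M.E) :
    M.Isomorphic (M.map f hf) :=
  isomorphic_of_bijOn f hf.bijOn_image fun _ hI ↦ (map_image_indep_iff hI).symm

lemma Isomorphic.exists_eq_map (h : M.Isomorphic N) (hne : M.E.Nonempty) :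
    ∃ (f : α → β) (hf : InjOn f M.E), N = M.map f hf := by
  obtain ⟨f, hf, hI⟩ := h.exists_bijOn hne
  refine ⟨f, hf.injOn, ext_indep hf.image_eq.symm fun I hIE ↦ ?_⟩
  obtain ⟨J, hJ, rfl⟩ := subset_image_iff.1 (hIE.trans hf.image_eq.symm.subset)
  rw [map_image_indep_iff hJ, hI J hJ]

lemma Isomorphic.dual (h : M.Isomorphic N) (hne : M.E.Nonempty) : M✶.Isomorphic N✶ := by
  obtain ⟨f, hf, rfl⟩ := h.exists_eq_map hne
  rw [map_dual]
  exact isomorphic_map M✶ f hf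

end Isomorphism

/-! ### Minors described by one contracted independent set. -/

section MinorIndep

variable {α : Type u} {M M' : Matroid α}

/-- Contracting a set has the same effect on independence as contracting a basis Z of it and
deleting the rest. With `exists_isMinor_of_indep` as converse, minors can be handled through Z
alone. -/
lemma IsMinor.exists_indep_union (h : M' ≤m M) :
    ∃ Z ⊆ M.E, Disjoint Z M'.E ∧ M.Indep Z ∧ ∀ I ⊆ M'.E, M'.Indep I ↔ M.Indep (I ∪ Z) := by
  obtain ⟨C, D, hC, hD, hCD, rfl⟩ := h.exists_eq_contract_delete_disjoint
  obtain ⟨Z, hZ⟩ := M.exists_isBasis' C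
  have hdj : Disjoint C (M ／ C ＼ D).E := by
    simp only [delete_ground, contract_ground]
    exact (disjoint_sdiff_right (t := M.E)).mono_right sdiff_subset
  refine ⟨Z, hZ.indep.subset_ground, hdj.mono_left hZ.subset, hZ.indep, fun I hI ↦ ?_⟩
  rw [delete_indep_iff, hZ.contract_indep_iff]
  have h1 : Disjoint C I := hdj.mono_right hI
  have h2 : Disjoint I D := by
    rw [delete_ground] at hI
    exact disjoint_sdiff_left.mono_left hI
  tauto

lemma IsMinor.dual (h : M' ≤m M) : M'✶ ≤m M✶ := by
  obtain ⟨C, D, rfl⟩ := h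
  rw [dual_contract_delete, delete_contract_comm']
  exact contract_delete_isMinor ..

lemma delete_isMinor (M : Matroid α) (D : Set α) : M ＼ D ≤m M := ⟨∅, D, by simp⟩

lemma contract_isMinor (M : Matroid α) (C : Set α) : M ／ C ≤m M := ⟨C, ∅, by simp⟩

lemma exists_isMinor_of_indep {Z X : Set α} (hZ : M.Indep Z) (hX : X ⊆ M.E) (hZX : Disjoint Z X) :
    ∃ M', M' ≤m M ∧ M'.E = X ∧ ∀ I ⊆ X, M'.Indep I ↔ M.Indep (I ∪ Z) := by
  refine ⟨M ／ Z ＼ (M.E \ X), contract_delete_isMinor .., ?_, fun I hI ↦ ?_⟩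
  · simp only [delete_ground, contract_ground]
    ext x
    have h1 : x ∈ X → x ∈ M.E := fun h ↦ hX h
    have h2 : x ∈ X → x ∉ Z := fun h ↦ disjoint_right.1 hZX h
    simp; tauto
  · rw [delete_indep_iff, hZ.contract_indep_iff]
    have h1 : Disjoint I Z := (hZX.mono_right hI).symm
    have h2 : Disjoint I (M.E \ X) := disjoint_sdiff_right.mono_left hI
    tauto

end MinorIndep

/-! ### N-connectedness and the inductive property. -/

section Inductive

variable {α : Type u} {β : Type v} {N : Matroid α} {M : Matroid β}

lemma exists_minor_isomorphic {s : α → β} {Z : Set β} (hs : MapsTo s N.E M.E)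
    (hinj : InjOn s N.E) (hZ : Disjoint Z (s '' N.E))
    (h : ∀ I ⊆ N.E, M.Indep (s '' I ∪ Z) ↔ N.Indep I) :
    ∃ M', M' ≤m M ∧ M'.Isomorphic N ∧ M'.E = s '' N.E := by
  have hZI : M.Indep Z := by simpa using h ∅ (empty_subset _)
  obtain ⟨M', hM', hE, hI⟩ := exists_isMinor_of_indep hZI hs.image_subset hZ
  refine ⟨M', hM', (isomorphic_of_bijOn s (hE ▸ hinj.bijOn_image) fun I hIX ↦ ?_).symm, hE⟩
  rw [hI _ (image_mono hIX), h I hIX]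

lemma minorConnected_of_forall (hM : M.E.Nontrivial)
    (h : ∀ e ∈ M.E, ∀ f ∈ M.E, e ≠ f → ∃ (s : α → β) (Z : Set β), MapsTo s N.E M.E ∧
      InjOn s N.E ∧ Disjoint Z (s '' N.E) ∧ (∀ I ⊆ N.E, M.Indep (s '' I ∪ Z) ↔ N.Indep I) ∧
      e ∈ s '' N.E ∧ f ∈ s '' N.E) :
    N.MinorConnected M := by
  refine ⟨hM, fun e he f hf hef ↦ ?_⟩
  obtain ⟨s, Z, hs, hinj, hZ, hI, heX, hfX⟩ := h e he f hf hef
  obtain ⟨M', hM', hi, hE⟩ := exists_minor_isomorphic hs hinj hZ hI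
  exact ⟨M', hM', hi, hE ▸ heX, hE ▸ hfX⟩

lemma MinorConnected.dual (h : N.MinorConnected M) : N✶.MinorConnected M✶ := by
  refine ⟨h.1, fun e he f hf hef ↦ ?_⟩
  obtain ⟨M', hM', hi, heM, hfM⟩ := h.2 e he f hf hef
  exact ⟨M'✶, hM'.dual, hi.dual ⟨e, heM⟩, heM, hfM⟩

lemma minorConnected_dual_iff : N✶.MinorConnected M✶ ↔ N.MinorConnected M :=
  ⟨fun h ↦ by simpa using h.dual, MinorConnected.dual⟩

/-- Duality exchanges deletion and contraction, and the property is symmetric in them. -/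
lemma InductiveProperty.dual (h : N.InductiveProperty) : N✶.InductiveProperty := by
  intro β M hM hc hlt e he
  have := h β M✶ inferInstance (by simpa using hc.dual) (by simpa using hlt) e he
  rw [← minorConnected_dual_iff, ← minorConnected_dual_iff (M := M ／ {e})]
  simpa [or_comm] using this

lemma Isomorphic.minorConnected_iff {γ : Type w} {N' : Matroid γ} (hN : N.Isomorphic N') :
    N.MinorConnected M ↔ N'.MinorConnected M := by
  refine and_congr_right fun _ ↦ ?_
  refine forall₅_congr fun e _ f _ _ ↦ exists_congr fun M' ↦ and_congr_right fun _ ↦ ?_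
  exact and_congr_left fun _ ↦ ⟨fun h ↦ h.trans hN, fun h ↦ h.trans hN.symm⟩

/-- If `N` has the inductive property, then every set of `|E(N)|` elements of an `N`-connected
matroid is the ground set of an `N`-minor. -/
lemma InductiveProperty.exists_minor {β : Type u} {M : Matroid β} [hM : M.Finite]
    (h : N.InductiveProperty) (hc : N.MinorConnected M) {X : Set β} (hX : X ⊆ M.E)
    (hXc : X.ncard = N.E.ncard) : ∃ M', M' ≤m M ∧ M'.Isomorphic N ∧ M'.E = X := by
  obtain ⟨n, hn⟩ : ∃ n, M.E.ncard = n := ⟨_, rfl⟩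
  induction n generalizing M with
  | zero =>
    obtain ⟨e, he, -⟩ := hc.1
    rw [ncard_eq_zero M.ground_finite] at hn
    simp [hn] at he
  | succ n ih =>
    -- If X is all of E(M), then M itself is the N-minor by cardinality; otherwise remove an element
    -- outside X.
    by_cases hXM : X = M.E
    · obtain ⟨e, he, f, hf, hef⟩ := hc.1
      obtain ⟨M', hM', hi, -⟩ := hc.2 e he f hf hef
      refine ⟨M', hM', hi, ?_⟩
      rw [hXM]
      refine eq_of_subset_of_ncard_le hM'.subset ?_ M.ground_finite
      rw [hi.ncard_eq, ← hXc, hXM]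
    obtain ⟨e, heM, heX⟩ := exists_of_ssubset (hX.ssubset_of_ne hXM)
    have hlt : N.E.ncard < M.E.ncard := by
      rw [← hXc]; exact ncard_lt_ncard (hX.ssubset_of_ne hXM) M.ground_finite
    have hcard : (M.E \ {e}).ncard = n := by
      rw [ncard_sdiff_singleton_of_mem heM, hn]; rfl
    have hX' : X ⊆ M.E \ {e} := subset_sdiff_singleton hX heX
    rcases h β M hM hc hlt e heM with h' | h'
    · obtain ⟨M', hM', h1⟩ := ih (M := M ＼ {e}) (hM := inferInstance) h' hX' hcard
      exact ⟨M', hM'.trans (delete_isMinor ..), h1⟩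
    · obtain ⟨M', hM', h1⟩ := ih (M := M ／ {e}) (hM := inferInstance) h' hX' hcard
      exact ⟨M', hM'.trans (contract_isMinor ..), h1⟩

/-- A coordinate form of `InductiveProperty.exists_minor`. -/
lemma InductiveProperty.exists_bijOn {β : Type u} {M : Matroid β} [M.Finite]
    (h : N.InductiveProperty) (hc : N.MinorConnected M) (hN : N.E.ncard ≠ 0) {X : Set β}
    (hX : X ⊆ M.E) (hXc : X.ncard = N.E.ncard) :
    ∃ (s : α → β) (Z : Set β), BijOn s N.E X ∧ Z ⊆ M.E ∧ Disjoint Z X ∧ M.Indep Z ∧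
      ∀ I ⊆ N.E, N.Indep I ↔ M.Indep (s '' I ∪ Z) := by
  obtain ⟨M', hM', hi, rfl⟩ := h.exists_minor hc hX hXc
  obtain ⟨s, hs, hI⟩ := hi.symm.exists_bijOn (nonempty_of_ncard_ne_zero hN)
  obtain ⟨Z, hZE, hZM, hZ, hIZ⟩ := hM'.exists_indep_union
  refine ⟨s, Z, hs, hZE, hZM, hZ, fun I hIE ↦ ?_⟩
  rw [hI I hIE, hIZ _ (hs.image_eq ▸ image_mono hIE)]

end Inductive

/-! ### Uniform matroids. -/

section Uniform

variable {α : Type u} {M : Matroid α} {r n : ℕ}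

lemma uniform_indep_iff {I : Set (Fin n)} : (uniform r n).Indep I ↔ I.ncard ≤ r := Iff.rfl

lemma uniform_ground : (uniform r n).E = univ := rfl

lemma isomorphic_uniform_iff (hn : n ≠ 0) : M.Isomorphic (uniform r n) ↔
    M.E.ncard = n ∧ ∀ I ⊆ M.E, M.Indep I ↔ I.ncard ≤ r := by
  constructor
  · intro h
    have hc : M.E.ncard = n := by simpa [uniform_ground] using h.ncard_eq
    refine ⟨hc, fun I hI ↦ ?_⟩
    obtain ⟨f, hf, hfI⟩ := h.exists_bijOn (nonempty_of_ncard_ne_zero (by rwa [hc]))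
    rw [hfI I hI, uniform_indep_iff, (hf.injOn.mono hI).ncard_image]
  · rintro ⟨hc, hI⟩
    have hfin : Finite M.E := finite_of_ncard_ne_zero (by rwa [hc])
    have φ : M.E ≃ (uniform r n).E :=
      (Finite.equivFinOfCardEq hc).trans (Equiv.Set.univ _).symm
    refine ⟨φ, fun I ↦ ?_⟩
    rw [hI _ (by simp), uniform_indep_iff]
    rw [ncard_image_of_injective _ Subtype.val_injective,
      ncard_image_of_injective _ Subtype.val_injective, ncard_image_of_injective _ φ.injective]

end Uniform

/-! ### Connected matroids and the case of U_{1,2}. -/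

section Connected

variable {α : Type u} {M : Matroid α} {e f x y z : α}

/-- Induction on |C₁ ∪ C₂|. Two strong eliminations give C₄ ⊆ C₁ ∪ C₂ through z that meets C₁ and
misses an element w of C₂ \ C₁, so C₁ ∪ C₄ is strictly smaller. -/
lemma IsCircuit.exists_of_inter_nonempty [M.Finite] {C₁ C₂ : Set α} (h₁ : M.IsCircuit C₁)
    (h₂ : M.IsCircuit C₂) (hne : (C₁ ∩ C₂).Nonempty) (hx : x ∈ C₁) (hz : z ∈ C₂) :
    ∃ C, M.IsCircuit C ∧ x ∈ C ∧ z ∈ C := by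
  obtain ⟨n, hn⟩ : ∃ n, (C₁ ∪ C₂).ncard = n := ⟨_, rfl⟩
  induction n using Nat.strong_induction_on generalizing C₁ C₂ with
  | _ n ih =>
  by_cases hx2 : x ∈ C₂
  · exact ⟨C₂, h₂, hx2, hz⟩
  by_cases hz1 : z ∈ C₁
  · exact ⟨C₁, h₁, hx, hz1⟩
  obtain ⟨y, hy1, hy2⟩ := hne
  obtain ⟨C₃, hC₃, h₃, hx3⟩ := h₁.strong_elimination h₂ hy1 hy2 hx hx2
  by_cases hz3 : z ∈ C₃
  · exact ⟨C₃, h₃, hx3, hz3⟩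
  obtain ⟨w, hw3, hw1⟩ : ∃ w ∈ C₃, w ∉ C₁ := by
    by_contra! hcon
    have := h₃.eq_of_subset_isCircuit h₁ hcon
    exact (hC₃ (this ▸ hy1)).2 rfl
  have hw2 : w ∈ C₂ := ((hC₃ hw3).1).resolve_left hw1
  obtain ⟨C₄, hC₄, h₄, hz4⟩ := h₂.strong_elimination h₃ hw2 hw3 hz hz3
  obtain ⟨v, hv4, hv2⟩ : ∃ v ∈ C₄, v ∉ C₂ := by
    by_contra! hcon
    have := h₄.eq_of_subset_isCircuit h₂ hcon
    exact (hC₄ (this ▸ hw2)).2 rfl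
  have hv3 : v ∈ C₃ := ((hC₄ hv4).1).resolve_left hv2
  have hv1 : v ∈ C₁ := ((hC₃ hv3).1).resolve_right hv2
  have hss : C₁ ∪ C₄ ⊂ C₁ ∪ C₂ := by
    rw [ssubset_iff_of_subset]
    · refine ⟨w, .inr hw2, ?_⟩
      rintro (h | h)
      · exact hw1 h
      · exact (hC₄ h).2 rfl
    · rintro a (ha | ha)
      · exact .inl ha
      · rcases (hC₄ ha).1 with h | h
        · exact .inr h
        · exact (hC₃ h).1
  have hfin : (C₁ ∪ C₂).Finite :=
    M.ground_finite.subset (union_subset h₁.subset_ground h₂.subset_ground)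
  exact ih _ (hn ▸ ncard_lt_ncard hss hfin) h₁ h₄ ⟨v, hv1, hv4⟩ hx hz4 rfl

/-- Two elements are connected to each other if they are equal or lie in a common circuit. -/
def ConnectedTo (M : Matroid α) (e f : α) : Prop := e = f ∨ ∃ C, M.IsCircuit C ∧ e ∈ C ∧ f ∈ C

lemma ConnectedTo.symm (h : M.ConnectedTo e f) : M.ConnectedTo f e :=
  h.imp Eq.symm fun ⟨C, hC, he, hf⟩ ↦ ⟨C, hC, hf, he⟩

lemma ConnectedTo.trans [M.Finite] (h : M.ConnectedTo x y) (h' : M.ConnectedTo y z) :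
    M.ConnectedTo x z := by
  obtain rfl | ⟨C, hC, hx, hy⟩ := h
  · exact h'
  obtain rfl | ⟨C', hC', hy', hz⟩ := h'
  · exact .inr ⟨C, hC, hx, hy⟩
  exact .inr (hC.exists_of_inter_nonempty hC' ⟨y, hy, hy'⟩ hx hz)

lemma isConnected_iff_connectedTo :
    M.IsConnected ↔ ∀ e ∈ M.E, ∀ f ∈ M.E, M.ConnectedTo e f :=
  ⟨fun h e he f hf ↦ or_iff_not_imp_left.2 fun hef ↦ h e he f hf hef,
    fun h e he f hf hef ↦ (h e he f hf).resolve_left hef⟩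

/-- Removing an element from a connected matroid by deletion or by contraction preserves
connectedness for at least one of the two. -/
lemma IsConnected.delete_or_contract [M.Finite] (h : M.IsConnected) (e : α) :
    (M ＼ {e}).IsConnected ∨ (M ／ {e}).IsConnected := by
  rw [or_iff_not_imp_left, isConnected_iff_connectedTo, isConnected_iff_connectedTo]
  intro hd
  push Not at hd
  obtain ⟨x, hx, y, hy, hxy⟩ := hd
  -- If deleting e separates a from b, then any circuit C through both contains e, and C - e is a
  -- circuit of the contraction.
  have key : ∀ a ∈ M.E \ {e}, ∀ b ∈ M.E \ {e}, ¬ (M ＼ {e}).ConnectedTo a b →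
      (M ／ {e}).ConnectedTo a b := by
    intro a ha b hb hab
    obtain ⟨C, hC, haC, hbC⟩ := h a ha.1 b hb.1 (fun h ↦ hab (.inl h))
    have heC : e ∈ C := by
      by_contra heC
      exact hab (.inr ⟨C, delete_isCircuit_iff.2 ⟨hC, by simpa using heC⟩, haC, hbC⟩)
    have hnt : C.Nontrivial := ⟨a, haC, e, heC, ha.2⟩
    exact .inr ⟨C \ {e}, hC.contractElem_isCircuit hnt heC, ⟨haC, ha.2⟩, ⟨hbC, hb.2⟩⟩
  intro a ha b hb
  -- If a and b lie in one component of the deletion, at least one of x, y lies outside it; route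
  -- through that element.
  by_cases hab : (M ＼ {e}).ConnectedTo a b
  · by_cases hax : (M ＼ {e}).ConnectedTo a x
    · refine (key a ha y hy fun hay ↦ hxy (hax.symm.trans hay)).trans
        (key b hb y hy fun hby ↦ hxy (hax.symm.trans (hab.trans hby))).symm
    · exact (key a ha x hx hax).trans (key b hb x hx fun hbx ↦ hax (hab.trans hbx)).symm
  · exact key a ha b hb hab

/-- A circuit C through e and f becomes U_{1,2} on {e, f} after contracting C \ {e, f}. Conversely,
if Z is contracted to obtain U_{1,2}, a circuit inside {e, f} ∪ Z must use both e and f. -/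
lemma minorConnected_uniform_one_two_iff :
    (uniform 1 2).MinorConnected M ↔ M.E.Nontrivial ∧ M.IsConnected := by
  refine and_congr_right fun _ ↦ forall₅_congr fun e he f hf hef ↦ ⟨?_, ?_⟩
  · rintro ⟨M', hM', hi, heM, hfM⟩
    obtain ⟨hc, hI⟩ := (isomorphic_uniform_iff (by simp)).1 hi
    obtain ⟨Z, hZE, -, -, hZ⟩ := hM'.exists_indep_union
    have h1 : M.Indep ({e} ∪ Z) := by
      rw [← hZ _ (by simpa), hI _ (by simpa)]; simp
    have h2 : M.Indep ({f} ∪ Z) := by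
      rw [← hZ _ (by simpa), hI _ (by simpa)]; simp
    have h3 : ¬ M.Indep ({e, f} ∪ Z) := by
      rw [← hZ _ (pair_subset heM hfM), hI _ (pair_subset heM hfM), ncard_pair hef]; simp
    rw [not_indep_iff (union_subset (pair_subset he hf) hZE)] at h3
    obtain ⟨C, hCs, hC⟩ := h3.exists_isCircuit_subset
    refine ⟨C, hC, ?_, ?_⟩
    · by_contra hn
      refine hC.not_indep (h2.subset fun x hx ↦ ?_)
      have := hCs hx
      have : x ≠ e := by rintro rfl; exact hn hx
      simp_all
    · by_contra hn
      refine hC.not_indep (h1.subset fun x hx ↦ ?_)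
      have := hCs hx
      have : x ≠ f := by rintro rfl; exact hn hx
      simp_all
  · rintro ⟨C, hC, heC, hfC⟩
    obtain ⟨M', hM', hE, hI⟩ := exists_isMinor_of_indep (M := M) (Z := C \ {e, f}) (X := {e, f})
      (hC.ssubset_indep ⟨sdiff_subset, fun h ↦ (h heC).2 (by simp)⟩) (pair_subset he hf)
      disjoint_sdiff_left
    refine ⟨M', hM', ?_, by simp [hE], by simp [hE]⟩
    rw [isomorphic_uniform_iff (by simp), hE]
    refine ⟨ncard_pair hef, fun I hIs ↦ ?_⟩
    rw [hI I hIs]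
    by_cases hIe : I = {e, f}
    · rw [hIe, ncard_pair hef, union_sdiff_cancel (pair_subset heC hfC)]
      simp [hC.not_indep]
    · have hlt := ncard_lt_ncard (hIs.ssubset_of_ne hIe)
      rw [ncard_pair hef] at hlt
      refine iff_of_true (hC.ssubset_indep ?_) (by omega)
      refine ⟨union_subset (hIs.trans (pair_subset heC hfC)) sdiff_subset, fun h ↦ hIe ?_⟩
      refine hIs.antisymm fun x hx ↦ ?_
      exact (h (pair_subset heC hfC hx)).resolve_right fun h ↦ h.2 hx

lemma inductiveProperty_of_isomorphic_uniform_one_two {N : Matroid α}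
    (h : N.Isomorphic (uniform 1 2)) : N.InductiveProperty := by
  intro β M hM hc hlt e he
  have hN : N.E.ncard = 2 := ((isomorphic_uniform_iff (by simp)).1 h).1
  rw [h.minorConnected_iff, minorConnected_uniform_one_two_iff] at *
  rw [h.minorConnected_iff, minorConnected_uniform_one_two_iff]
  have hnt : (M.E \ {e}).Nontrivial := by
    refine (one_lt_ncard_iff_nontrivial_and_finite.1 ?_).1
    rw [ncard_sdiff_singleton_of_mem he]
    omega
  exact (hc.2.delete_or_contract e).imp (fun h ↦ ⟨hnt, h⟩) fun h ↦ ⟨hnt, h⟩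

end Connected

/-! ### Replacing an element by copies of itself. -/

section Blowup

variable {α : Type u} {N : Matroid α} {p q : α}

/-- Replace the element `p` of `N` by `n` copies of itself, leaving every other element as it is. -/
def blowup (N : Matroid α) (p : α) (n : ℕ) : Matroid (α × ℕ) :=
  N.comapOn {x | x.1 ∈ N.E ∧ x.2 < n ∧ (x.1 ≠ p → x.2 = 0)} Prod.fst

lemma blowup_ground (N : Matroid α) (p : α) (n : ℕ) :
    (N.blowup p n).E = {x | x.1 ∈ N.E ∧ x.2 < n ∧ (x.1 ≠ p → x.2 = 0)} := rfl

lemma blowup_indep_iff {n : ℕ} {I : Set (α × ℕ)} : (N.blowup p n).Indep I ↔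
    N.Indep (Prod.fst '' I) ∧ InjOn Prod.fst I ∧ I ⊆ (N.blowup p n).E := comapOn_indep_iff

lemma blowup_finite [N.Finite] (p : α) (n : ℕ) : (N.blowup p n).Finite :=
  ⟨(N.ground_finite.prod (finite_Iio n)).subset fun _ hx ↦ ⟨hx.1, hx.2.1⟩⟩

/-- Elements with different labels extend to a transversal, which is a copy of N. Two copies of p
can play the roles of p and q, because these are interchangeable and dependent together. -/
lemma blowup_minorConnected {n : ℕ} (hn : 2 ≤ n) (hp : p ∈ N.E) (hq : q ∈ N.E) (hpq : p ≠ q)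
    (hdep : ¬ N.Indep {p, q})
    (hswap : ∀ I ⊆ N.E \ {p, q}, N.Indep (insert p I) ↔ N.Indep (insert q I)) :
    N.MinorConnected (N.blowup p n) := by
  classical
  refine minorConnected_of_forall ⟨(p, 0), ⟨hp, by simp; omega⟩, (p, 1), ⟨hp, by simp; omega⟩,
    by simp⟩ ?_
  rintro ⟨a, i⟩ ⟨ha, hi, hai⟩ ⟨b, j⟩ ⟨hb, hj, hbj⟩ hne
  simp only at ha hi hai hb hj hbj
  by_cases hab : a = b
  · subst hab
    have hap : a = p := by
      by_contra hap
      exact hne (by rw [hai hap, hbj hap])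
    subst hap
    set s : α → α × ℕ := fun c ↦ if c = q then (a, j) else if c = a then (a, i) else (c, 0) with hs
    have hsE : MapsTo s N.E (N.blowup a n).E := by
      intro c hc
      rw [blowup_ground]
      by_cases h1 : c = q
      · simp [hs, h1, ha, hj]
      by_cases h2 : c = a
      · simp [hs, h2, ha, hi, hpq]
      · simp [hs, h1, h2, hc]; omega
    have hinj : InjOn s N.E := by
      intro c hc d hd hcd
      simp only [hs] at hcd
      have : i ≠ j := by rintro rfl; exact hne rfl
      split_ifs at hcd <;> simp_all
    refine ⟨s, ∅, hsE, hinj, empty_disjoint _, fun I hI ↦ ?_, ⟨a, ha, by simp [hs, hpq]⟩,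
      ⟨q, hq, by simp [hs]⟩⟩
    have hsq : s q = (a, j) := by simp [hs]
    have hfst : ∀ c, c ≠ q → (s c).1 = c := by
      intro c hc
      by_cases h2 : c = a
      · simp [hs, h2, hpq]
      · simp [hs, hc, h2]
    have hsI : s '' I ⊆ (N.blowup a n).E := image_subset_iff.2 fun c hc ↦ hsE (hI hc)
    rw [union_empty, blowup_indep_iff, and_iff_left hsI]
    have himg : ∀ K : Set α, q ∉ K → Prod.fst '' (s '' K) = K := by
      intro K hK
      rw [image_image]
      refine (image_congr fun c hc ↦ hfst c ?_).trans (image_id _)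
      rintro rfl; exact hK hc
    have hinjon : ∀ K : Set α, q ∉ K → InjOn Prod.fst (s '' K) := by
      rintro K hK _ ⟨c, hc, rfl⟩ _ ⟨d, hd, rfl⟩ h
      rw [hfst c (by rintro rfl; exact hK hc), hfst d (by rintro rfl; exact hK hd)] at h
      rw [h]
    by_cases hqI : q ∈ I
    · by_cases haI : a ∈ I
      · refine iff_of_false ?_ (fun h ↦ hdep (h.subset (pair_subset haI hqI)))
        rintro ⟨-, h⟩
        have h1 := h ⟨a, haI, rfl⟩ ⟨q, hqI, rfl⟩ (by rw [hfst a hpq, hsq])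
        exact hpq (hinj ha hq h1)
      · obtain ⟨K, hqK, rfl⟩ : ∃ K, q ∉ K ∧ insert q K = I :=
          ⟨I \ {q}, by simp, by simp [hqI]⟩
        rw [image_insert_eq, image_insert_eq, himg K hqK, hsq, ← hswap K, and_iff_left]
        · have haK : a ∉ K := fun h ↦ haI (.inr h)
          rw [injOn_insert]
          · refine ⟨hinjon K hqK, ?_⟩
            rw [himg K hqK]
            exact haK
          · rintro ⟨c, hc, h⟩
            have := hfst c (by rintro rfl; exact hqK hc)
            rw [h] at this
            exact haK ((show a = c from this) ▸ hc)
        · intro c hc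
          refine ⟨hI (.inr hc), ?_⟩
          rintro (rfl | rfl)
          · exact haI (.inr hc)
          · exact hqK hc
    · rw [himg I hqI, and_iff_left (hinjon I hqI)]
  · set s : α → α × ℕ := fun c ↦ (c, if c = a then i else if c = b then j else 0) with hs
    have hsE : MapsTo s N.E (N.blowup p n).E := by
      intro c hc
      refine ⟨hc, ?_, ?_⟩
      · simp only [hs]; split_ifs <;> omega
      · simp only [hs]
        intro hcp
        split_ifs with h1 h2
        · subst h1; exact hai hcp
        · subst h2; exact hbj hcp
        · rfl
    refine ⟨s, ∅, hsE, fun c _ d _ h ↦ congrArg Prod.fst h, empty_disjoint _, fun I hI ↦ ?_,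
      ⟨a, ha, by simp [hs]⟩, ⟨b, hb, by simp [hs, Ne.symm hab]⟩⟩
    rw [union_empty, blowup_indep_iff, image_image, image_id', and_iff_left]
    refine ⟨?_, image_subset_iff.2 fun c hc ↦ hsE (hI hc)⟩
    rintro _ ⟨c, -, rfl⟩ _ ⟨d, -, rfl⟩ (h : c = d)
    rw [h]

/-- A matroid with the inductive property and with two parallel elements or two loops is a uniform
matroid of rank at most one. -/
lemma InductiveProperty.not_indep_pair [N.Finite] (h : N.InductiveProperty) (hp : p ∈ N.E)
    (hq : q ∈ N.E) (hpq : p ≠ q) (hdep : ¬ N.Indep {p, q})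
    (hswap : ∀ I ⊆ N.E \ {p, q}, N.Indep (insert p I) ↔ N.Indep (insert q I)) :
    (∀ a ∈ N.E, ∀ b ∈ N.E, a ≠ b → ¬ N.Indep {a, b}) ∧
      ∀ a ∈ N.E, ∀ b ∈ N.E, N.Indep {a} → N.Indep {b} := by
  set n := N.E.ncard with hn
  have hn2 : 2 ≤ n := by
    rw [hn, ← ncard_pair hpq]
    exact ncard_le_ncard (pair_subset hp hq) N.ground_finite
  have hc := blowup_minorConnected hn2 hp hq hpq hdep hswap
  have := blowup_finite (N := N) p n
  -- All copies of p: no two are independent together, and all behave alike with any Z disjoint from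
  -- X, as such a Z has no label p.
  set X : Set (α × ℕ) := (fun i ↦ (p, i)) '' Iio n with hX
  have hinjX : Function.Injective fun i : ℕ ↦ (p, i) := fun i j h ↦ congrArg Prod.snd h
  have hXE : X ⊆ (N.blowup p n).E := by
    rintro _ ⟨i, hi, rfl⟩
    exact ⟨hp, hi, fun h ↦ (h rfl).elim⟩
  obtain ⟨s, Z, hs, hZE, hZX, hZ, hI⟩ := h.exists_bijOn hc (by omega) hXE
    (by rw [hX, ncard_image_of_injective _ hinjX, ← Finset.coe_Iio, ncard_coe_finset]; simp [hn])
  have hfst : ∀ a ∈ N.E, (s a).1 = p := by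
    intro a ha
    obtain ⟨i, -, hi⟩ := hs.mapsTo ha
    rw [← hi]
  have hZp : p ∉ Prod.fst '' Z := by
    rintro ⟨⟨_, i⟩, hz, rfl⟩
    exact disjoint_left.1 hZX hz ⟨i, (hZE hz).2.1, rfl⟩
  refine ⟨fun a ha b hb hab ↦ ?_, fun a ha b hb ↦ ?_⟩
  · rw [hI _ (pair_subset ha hb), blowup_indep_iff]
    rintro ⟨-, h, -⟩
    exact hab <| hs.injOn ha hb <| h (.inl ⟨a, by simp, rfl⟩) (.inl ⟨b, by simp, rfl⟩)
      (by rw [hfst a ha, hfst b hb])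
  · rw [hI _ (by simpa), hI _ (by simpa), blowup_indep_iff, blowup_indep_iff, image_singleton,
      image_singleton, singleton_union, singleton_union, image_insert_eq, image_insert_eq,
      hfst a ha, hfst b hb]
    rintro ⟨h1, -, -⟩
    refine ⟨h1, ?_, insert_subset (hXE (hs.mapsTo hb)) hZE⟩
    rw [injOn_insert (fun h ↦ disjoint_left.1 hZX h (hs.mapsTo hb)), hfst b hb]
    exact ⟨(blowup_indep_iff.1 hZ).2.1, hZp⟩

end Blowup

/-! ### Excluding matroids made only of loops. -/

section Loopy

variable {α : Type u} {N : Matroid α}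

/-- The matroid on `E` and one further element in which the elements of `E` are parallel
and the further element is a loop. -/
def parallelAddLoop (E : Set α) : Matroid (Option α) :=
  -- The value `false` lies outside the ground set of `freeOn {true}`, which makes `none` a loop.
  (freeOn {true}).comapOn (insert none (some '' E)) Option.isSome

lemma parallelAddLoop_indep_iff {E : Set α} {I : Set (Option α)} :
    (parallelAddLoop E).Indep I ↔ I ⊆ some '' E ∧ I.Subsingleton := by
  rw [parallelAddLoop, comapOn_indep_iff, freeOn_indep_iff]
  constructor
  · rintro ⟨h1, h2, h3⟩
    refine ⟨fun x hx ↦ (h3 hx).resolve_left ?_, fun x hx y hy ↦ h2 hx hy ?_⟩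
    · rintro rfl
      simpa using h1 ⟨none, hx, rfl⟩
    · rw [h1 ⟨x, hx, rfl⟩, h1 ⟨y, hy, rfl⟩]
  · rintro ⟨h1, h2⟩
    refine ⟨?_, h2.injOn _, h1.trans (subset_insert _ _)⟩
    rintro _ ⟨x, hx, rfl⟩
    obtain ⟨y, -, rfl⟩ := h1 hx
    rfl

/-- Suppose N is all loops. In n parallel elements plus a loop, contracting any parallel element
leaves n loops, so this matroid is N-connected; yet the parallel elements themselves carry no
N-minor, since the only other element is a loop. -/
lemma InductiveProperty.exists_indep_singleton [N.Finite] (h : N.InductiveProperty)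
    (hcard : 3 ≤ N.E.ncard) : ∃ e ∈ N.E, N.Indep {e} := by
  classical
  by_contra! hcon
  have hN : ∀ I, N.Indep I ↔ I = ∅ := by
    refine fun I ↦ ⟨fun hI ↦ ?_, fun hI ↦ by simp [hI]⟩
    by_contra hne
    obtain ⟨x, hx⟩ := nonempty_iff_ne_empty.2 hne
    exact hcon x (hI.subset_ground hx) (hI.subset (by simpa))
  set M := parallelAddLoop N.E with hM
  have hME : M.E = insert none (some '' N.E) := rfl
  have hfin : M.Finite := ⟨by rw [hME]; exact (N.ground_finite.image _).insert _⟩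
  -- Here n ≥ 3 matters: some parallel element outside {e, f} is free to be contracted.
  have avoid : ∀ e f : Option α, ∃ c ∈ N.E, some c ≠ e ∧ some c ≠ f := by
    intro e f
    by_contra! hcon
    have h1 : some '' N.E ⊆ {e, f} := by
      rintro _ ⟨c, hc, rfl⟩
      by_cases hce : some c = e
      · exact .inl hce
      · exact .inr (hcon c hc hce)
    have h2 := ncard_le_ncard h1
    rw [ncard_image_of_injective _ (Option.some_injective α)] at h2
    have := ncard_insert_le e {f}
    rw [ncard_singleton] at this
    omega
  have hc : N.MinorConnected M := by
    obtain ⟨c, hc, -⟩ := avoid none none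
    refine minorConnected_of_forall ⟨none, .inl rfl, some c, .inr ⟨c, hc, rfl⟩, by simp⟩ ?_
    intro e he f hf hef
    obtain ⟨c, hc, hce, hcf⟩ := avoid e f
    -- The loop takes over the role of the contracted element c.
    set s : α → Option α := fun x ↦ if x = c then none else some x with hs
    have hsc : ∀ x, s x ≠ some c := by
      intro x
      by_cases hx : x = c
      · simp [hs, hx]
      · simp [hs, hx]
    have hmem : ∀ g ∈ M.E, some c ≠ g → g ∈ s '' N.E := by
      rintro g (rfl | ⟨x, hx, rfl⟩) hg
      · exact ⟨c, hc, by simp [hs]⟩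
      · exact ⟨x, hx, by simp only [hs]; rw [if_neg]; rintro rfl; exact hg rfl⟩
    refine ⟨s, {some c}, fun x hx ↦ ?_, fun x _ y _ hxy ↦ ?_, ?_, fun I hI ↦ ?_,
      hmem e he hce, hmem f hf hcf⟩
    · by_cases hxc : x = c
      · exact .inl (by simp [hs, hxc])
      · exact .inr ⟨x, hx, by simp [hs, hxc]⟩
    · simp only [hs] at hxy
      split_ifs at hxy <;> simp_all
    · rw [disjoint_singleton_left]
      rintro ⟨x, -, hx⟩
      exact hsc x hx
    · rw [hN, parallelAddLoop_indep_iff]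
      constructor
      · rintro ⟨-, h2⟩
        by_contra hne
        obtain ⟨x, hx⟩ := nonempty_iff_ne_empty.2 hne
        exact hsc x (h2 (.inl ⟨x, hx, rfl⟩) (.inr rfl))
      · rintro rfl
        simp [hc]
  obtain ⟨s, Z, hs, hZE, hZX, hZ, hI⟩ := h.exists_bijOn hc (by omega)
    (X := some '' N.E) (subset_insert _ _) (ncard_image_of_injective _ (Option.some_injective α))
  obtain rfl : Z = ∅ := by
    have := (parallelAddLoop_indep_iff.1 hZ).1
    exact hZX.eq_bot_of_le this
  obtain ⟨c, hc, -⟩ := avoid none none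
  refine hcon c hc ((hI _ (by simpa)).2 ?_)
  rw [parallelAddLoop_indep_iff]
  simpa using hs.mapsTo hc

end Loopy

/-! ### Excluding a loop plus a coloop, via the rank-three whirl. -/

section Whirl

/-- Independence in the rank-three whirl with the three-point lines `{0, 1, 2}`, `{2, 3, 4}` and
`{4, 5, 0}`. -/
def WhirlIndep (I : Finset (Fin 6)) : Prop :=
  I.card ≤ 3 ∧ I ≠ {0, 1, 2} ∧ I ≠ {2, 3, 4} ∧ I ≠ {4, 5, 0}

instance : DecidablePred WhirlIndep := fun _ ↦ inferInstanceAs (Decidable (_ ∧ _))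

/-- The rank-three whirl. -/
def whirl : Matroid (Fin 6) :=
  (IndepMatroid.ofFinset univ WhirlIndep (by decide)
    (have h : ∀ J : Finset (Fin 6), WhirlIndep J → ∀ I ⊆ J, WhirlIndep I := by decide +kernel
     fun I J hJ hIJ ↦ h J hJ I hIJ)
    (have h : ∀ I J : Finset (Fin 6), WhirlIndep I → WhirlIndep J → I.card < J.card →
        ∃ e ∈ J, e ∉ I ∧ WhirlIndep (insert e I) := by decide +kernel
     fun I J hI hJ hlt ↦ h I J hI hJ hlt)
    (fun I _ ↦ subset_univ _)).matroid

lemma whirl_indep_iff {I : Finset (Fin 6)} : whirl.Indep I ↔ WhirlIndep I :=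
  by simp [whirl]

variable {α : Type u} {N : Matroid α}

/-- The direct sum of a loop and a coloop does not have the inductive property. -/
lemma InductiveProperty.isLoop_of_isLoop {a b : α} (h : N.InductiveProperty) (hE : N.E = {a, b})
    (hab : a ≠ b) (ha : ¬ N.Indep {a}) : ¬ N.Indep {b} := by
  classical
  intro hb
  have hN : ∀ I ⊆ N.E, N.Indep I ↔ a ∉ I := by
    refine fun I hI ↦ ⟨fun hI haI ↦ ha (hI.subset (by simpa)), fun haI ↦ hb.subset fun x hx ↦ ?_⟩
    rw [hE] at hI
    exact (hI hx).resolve_left (by rintro rfl; exact haI hx)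
  have hcard : N.E.ncard = 2 := by rw [hE, ncard_pair hab]
  -- The lift puts the whirl in the universe over which the inductive property quantifies.
  set M : Matroid (ULift.{u} (Fin 6)) := whirl.comap ULift.down with hM
  have hME : M.E = univ := rfl
  have hMI : ∀ T : Finset (Fin 6), M.Indep (ULift.up '' T) ↔ WhirlIndep T := by
    intro T
    rw [hM, comap_indep_iff, and_iff_left ULift.down_injective.injOn, image_image, image_id',
      whirl_indep_iff]
  have hfin : M.Finite := ⟨toFinite _⟩
  have hT : ∀ Z : Set (ULift.{u} (Fin 6)), ∃ T : Finset (Fin 6), Z = ULift.up '' T := by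
    refine fun Z ↦ ⟨(toFinite (ULift.down '' Z)).toFinset, ?_⟩
    simp [image_image]
  have hmem : ∀ (e : Fin 6) (T : Finset (Fin 6)),
      ULift.up.{u} e ∈ ULift.up '' (T : Set (Fin 6)) ↔ e ∈ T := by simp
  have hins : ∀ (e : Fin 6) (T : Finset (Fin 6)),
      insert (ULift.up.{u} e) (ULift.up '' T) = ULift.up '' (insert e T : Finset (Fin 6)) := by
    simp [image_insert_eq]
  have hc : N.MinorConnected M := by
    refine minorConnected_of_forall ⟨⟨0⟩, trivial, ⟨1⟩, trivial, by simp⟩ ?_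
    have key : ∀ (e f : Fin 6) (T : Finset (Fin 6)), e ≠ f → e ∉ T → f ∉ T → WhirlIndep T →
        WhirlIndep (insert f T) → ¬ WhirlIndep (insert e T) →
        ∃ (s : α → ULift.{u} (Fin 6)) (Z : Set _), MapsTo s N.E M.E ∧
        InjOn s N.E ∧ Disjoint Z (s '' N.E) ∧ (∀ I ⊆ N.E, M.Indep (s '' I ∪ Z) ↔ N.Indep I) ∧
        ⟨e⟩ ∈ s '' N.E ∧ ⟨f⟩ ∈ s '' N.E := by
      intro e f T hef heT hfT hTi hfi hei
      refine ⟨fun x ↦ if x = a then ⟨e⟩ else ⟨f⟩, ULift.up '' T, fun _ _ ↦ trivial, ?_, ?_,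
        fun I hI ↦ ?_, ⟨a, by simp [hE], by simp⟩, ⟨b, by simp [hE], by simp [hab.symm]⟩⟩
      · rw [hE, injOn_pair]
        simp [hab.symm, hef]
      · rw [hE, image_pair]
        simp [hab.symm, heT, hfT]
      · rw [hN I hI]
        constructor
        · intro hi haI
          refine hei ((hMI _).1 (hi.subset ?_))
          rw [← hins]
          exact insert_subset (.inl ⟨a, haI, by simp⟩) subset_union_right
        · intro haI
          refine ((hMI _).2 hfi).subset ?_
          rw [← hins]
          refine union_subset ?_ (subset_insert _ _)
          rintro _ ⟨x, hx, rfl⟩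
          have : x ≠ a := by rintro rfl; exact haI hx
          simp [this]
    -- Every pair is split by an independent T that spans exactly one of its members; contracting T
    -- makes that one the loop.
    have dec : ∀ e f : Fin 6, e ≠ f → ∃ T : Finset (Fin 6), e ∉ T ∧ f ∉ T ∧ WhirlIndep T ∧
      ((WhirlIndep (insert f T) ∧ ¬ WhirlIndep (insert e T)) ∨
        (WhirlIndep (insert e T) ∧ ¬ WhirlIndep (insert f T))) := by decide +kernel
    rintro ⟨e⟩ - ⟨f⟩ - hef
    have hef' : e ≠ f := by rintro rfl; exact hef rfl
    obtain ⟨T, heT, hfT, hTi, ⟨h1, h2⟩ | ⟨h1, h2⟩⟩ := dec e f hef'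
    · exact key e f T hef' heT hfT hTi h1 h2
    · obtain ⟨s, Z, h1, h2, h3, h4, h5, h6⟩ := key f e T hef'.symm hfT heT hTi h1 h2
      exact ⟨s, Z, h1, h2, h3, h4, h6, h5⟩
  -- An N-minor on {e, f} has exactly one loop, so it cannot exist when e and f are interchangeable.
  have hclone : ∀ (M' : Matroid (ULift.{u} (Fin 6))) (e f : ULift.{u} (Fin 6)), e ≠ f →
      M'.Isomorphic N → e ∈ M'.E → f ∈ M'.E → ¬ (M'.Indep {e} ↔ M'.Indep {f}) := by
    intro M' e f hef hi he hf
    obtain ⟨g, hg, hI⟩ := hi.exists_bijOn ⟨e, he⟩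
    rw [hI _ (by simpa), hI _ (by simpa), image_singleton, image_singleton]
    have h1 := hg.mapsTo he
    have h2 := hg.mapsTo hf
    have h3 : g e ≠ g f := fun h ↦ hef (hg.injOn he hf h)
    rw [hE] at h1 h2
    rcases h1 with h1 | h1 <;> rcases h2 with h2 | h2 <;> simp_all
  -- The point 1 lies only on the line {0, 1, 2}. Deleting it makes 2 and 3 interchangeable, both
  -- lying only on {2, 3, 4}; contracting it makes 0 and 2 parallel.
  rcases h _ M hfin hc (by rw [hcard, hME, ncard_univ]; simp) ⟨1⟩ trivial with h' | h'
  · obtain ⟨M', hM', hi, he, hf⟩ := h'.2 ⟨2⟩ ⟨trivial, by simp⟩ ⟨3⟩ ⟨trivial, by simp⟩ (by simp)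
    refine hclone M' _ _ (by simp) hi he hf ?_
    obtain ⟨Z, hZE, hZM, -, hI⟩ := hM'.exists_indep_union
    rw [hI _ (by simpa), hI _ (by simpa), singleton_union, singleton_union]
    have h1Z : (⟨1⟩ : ULift.{u} (Fin 6)) ∉ Z := fun h ↦ (hZE h).2 rfl
    have h2Z := disjoint_right.1 hZM he
    have h3Z := disjoint_right.1 hZM hf
    have aux : ∀ (e : ULift.{u} (Fin 6)), e ≠ ⟨1⟩ →
        ((M ＼ {⟨1⟩}).Indep (insert e Z) ↔ M.Indep (insert e Z)) := by
      intro e he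
      rw [delete_indep_iff, and_iff_left]
      rw [disjoint_singleton_right]
      rintro (h | h)
      · exact he h.symm
      · exact h1Z h
    rw [aux _ (by simp), aux _ (by simp)]
    obtain ⟨T, rfl⟩ := hT Z
    rw [hmem] at h1Z h2Z h3Z
    rw [hins, hins, hMI, hMI]
    have dec : ∀ T : Finset (Fin 6), 1 ∉ T → 2 ∉ T → 3 ∉ T →
      (WhirlIndep (insert 2 T) ↔ WhirlIndep (insert 3 T)) := by decide +kernel
    exact dec T h1Z h2Z h3Z
  · obtain ⟨M', hM', hi, he, hf⟩ := h'.2 ⟨0⟩ ⟨trivial, by simp⟩ ⟨2⟩ ⟨trivial, by simp⟩ (by simp)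
    refine hclone M' _ _ (by simp) hi he hf ?_
    obtain ⟨Z, hZE, hZM, -, hI⟩ := hM'.exists_indep_union
    rw [hI _ (by simpa), hI _ (by simpa), singleton_union, singleton_union]
    have h1Z : (⟨1⟩ : ULift.{u} (Fin 6)) ∉ Z := fun h ↦ (hZE h).2 rfl
    have h0Z := disjoint_right.1 hZM he
    have h2Z := disjoint_right.1 hZM hf
    have hnl : M.Indep {⟨1⟩} := by
      have := (hMI {1}).2 (by decide)
      simpa using this
    have aux : ∀ (e : ULift.{u} (Fin 6)), e ≠ ⟨1⟩ →
        ((M ／ {⟨1⟩}).Indep (insert e Z) ↔ M.Indep (insert e (insert ⟨1⟩ Z))) := by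
      intro e he
      rw [hnl.contract_indep_iff, union_singleton, insert_comm, and_iff_right]
      rw [disjoint_singleton_right]
      rintro (h | h)
      · exact he h.symm
      · exact h1Z h
    rw [aux _ (by simp), aux _ (by simp)]
    obtain ⟨T, rfl⟩ := hT Z
    rw [hmem] at h1Z h0Z h2Z
    rw [hins, hins, hins, hMI, hMI]
    have dec : ∀ T : Finset (Fin 6), 1 ∉ T → 0 ∉ T → 2 ∉ T →
      (WhirlIndep (insert 0 (insert 1 T)) ↔ WhirlIndep (insert 2 (insert 1 T))) := by
      decide +kernel
    exact dec T h1Z h0Z h2Z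

end Whirl

/-! ### Parallel connection with the basepoint deleted. -/

section TiedSum

variable {ι : Type v} {α : Type u} {D : Matroid α} {I J : Set α} {p : α}

lemma Indep.exists_insert_of_ncard_lt [D.Finite] (hI : D.Indep I) (hJ : D.Indep J)
    (h : I.ncard < J.ncard) : ∃ e ∈ J \ I, D.Indep (insert e I) := by
  refine hI.augment hJ ?_
  rwa [← (D.ground_finite.subset hI.subset_ground).cast_ncard_eq,
    ← (D.ground_finite.subset hJ.subset_ground).cast_ncard_eq, Nat.cast_lt]

/-- Augments I without making it span p: extend I + p instead, from J if it is larger by two, or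
from J + p if that is independent. -/
lemma Indep.exists_insert_not_dep [D.Finite] (hI : D.Indep I) (hJ : D.Indep J) (hpI : p ∉ I)
    (hpJ : p ∉ J) (hI' : ¬ D.Dep (insert p I)) (hlt : I.ncard < J.ncard)
    (h : I.ncard + 1 < J.ncard ∨ ¬ D.Dep (insert p J)) :
    ∃ e ∈ J \ I, D.Indep (insert e I) ∧ ¬ D.Dep (insert p (insert e I)) := by
  by_cases hp : p ∈ D.E
  · rw [not_dep_iff (insert_subset hp hI.subset_ground)] at hI'
    rw [not_dep_iff (insert_subset hp hJ.subset_ground)] at h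
    have hIc : (insert p I).ncard = I.ncard + 1 :=
      ncard_insert_of_notMem hpI (D.ground_finite.subset hI.subset_ground)
    have hJc : (insert p J).ncard = J.ncard + 1 :=
      ncard_insert_of_notMem hpJ (D.ground_finite.subset hJ.subset_ground)
    obtain ⟨e, he, hi⟩ : ∃ e ∈ J \ I, D.Indep (insert e (insert p I)) := by
      rcases h with h | h
      · obtain ⟨e, he, hi⟩ := hI'.exists_insert_of_ncard_lt hJ (by omega)
        exact ⟨e, ⟨he.1, fun h ↦ he.2 (.inr h)⟩, hi⟩
      · obtain ⟨e, he, hi⟩ := hI'.exists_insert_of_ncard_lt h (by omega)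
        exact ⟨e, ⟨he.1.resolve_left fun h ↦ he.2 (.inl h), fun h ↦ he.2 (.inr h)⟩, hi⟩
    exact ⟨e, he, hi.subset (insert_subset_insert (subset_insert _ _)),
      fun hd ↦ hd.not_indep (by rwa [insert_comm])⟩
  · obtain ⟨e, he, hi⟩ := hI.exists_insert_of_ncard_lt hJ hlt
    exact ⟨e, he, hi, fun hd ↦ hp (hd.subset_ground (mem_insert _ _))⟩

lemma ncard_eq_sum_fiber [Fintype ι] {I : Set (ι × α)} (hI : I.Finite) :
    I.ncard = ∑ i, (Prod.mk i ⁻¹' I).ncard := by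
  classical
  rw [ncard_eq_toFinset_card _ hI,
    Finset.card_eq_sum_card_fiberwise (f := Prod.fst) (t := Finset.univ) (by simp [MapsTo])]
  refine Finset.sum_congr rfl fun i _ ↦ ?_
  rw [← ncard_coe_finset, ← ncard_image_of_injective (Prod.mk i ⁻¹' I) (Prod.mk_right_injective i)]
  congr 1
  ext ⟨j, a⟩
  simp only [Finset.coe_filter, Finite.mem_toFinset, mem_ofPred_eq, mem_image, mem_preimage,
    Prod.mk.injEq]
  constructor
  · rintro ⟨h, rfl⟩
    exact ⟨a, h, rfl, rfl⟩
  · rintro ⟨b, h, rfl, rfl⟩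
    exact ⟨h, rfl⟩

lemma preimage_mk_insert_self (I : Set (ι × α)) (i : ι) (e : α) :
    Prod.mk i ⁻¹' (insert (i, e) I) = insert e (Prod.mk i ⁻¹' I) := by
  ext; simp

lemma preimage_mk_insert_of_ne (I : Set (ι × α)) {i k : ι} (hk : k ≠ i) (e : α) :
    Prod.mk k ⁻¹' (insert (i, e) I) = Prod.mk k ⁻¹' I := by
  ext; simp [hk]

/-- Independence in the parallel connection at `p` of the matroids `D i`, with `p` deleted. -/
def TiedIndep (D : ι → Matroid α) (p : α) (I : Set (ι × α)) : Prop :=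
  (∀ i, (D i).Indep (Prod.mk i ⁻¹' I) ∧ p ∉ Prod.mk i ⁻¹' I) ∧
    ∀ i j, (D i).Dep (insert p (Prod.mk i ⁻¹' I)) → (D j).Dep (insert p (Prod.mk j ⁻¹' I)) → i = j

variable {D : ι → Matroid α}

lemma TiedIndep.insert {I : Set (ι × α)} {i : ι} {e : α} (hI : TiedIndep D p I) (hep : e ≠ p)
    (hi : (D i).Indep (insert e (Prod.mk i ⁻¹' I)))
    (h : ∀ k ≠ i, (D k).Dep (insert p (Prod.mk k ⁻¹' I)) →
      ¬ (D i).Dep (insert p (insert e (Prod.mk i ⁻¹' I)))) :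
    TiedIndep D p (insert (i, e) I) := by
  refine ⟨fun k ↦ ?_, fun k l hk hl ↦ ?_⟩
  · by_cases hk : k = i
    · subst hk
      rw [preimage_mk_insert_self]
      refine ⟨hi, ?_⟩
      rintro (h | h)
      · exact hep h.symm
      · exact (hI.1 k).2 h
    · rw [preimage_mk_insert_of_ne _ hk]
      exact hI.1 k
  · by_contra hkl
    by_cases hki : k = i
    · subst hki
      rw [preimage_mk_insert_self] at hk
      rw [preimage_mk_insert_of_ne _ (Ne.symm hkl)] at hl
      exact h l (Ne.symm hkl) hl hk
    · rw [preimage_mk_insert_of_ne _ hki] at hk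
      by_cases hli : l = i
      · subst hli
        rw [preimage_mk_insert_self] at hl
        exact h k hkl hk hl
      · rw [preimage_mk_insert_of_ne _ hli] at hl
        exact hkl (hI.2 k l hk hl)

/-- The only obstruction to augmenting within one fibre is that a second fibre might come to span p.
Hence the delicate case is when a fibre j of I already spans p. -/
lemma TiedIndep.augment [Fintype ι] (hD : ∀ i, (D i).Finite) {I J : Set (ι × α)}
    (hIfin : I.Finite) (hJfin : J.Finite) (hI : TiedIndep D p I) (hJ : TiedIndep D p J)
    (hlt : I.ncard < J.ncard) : ∃ e ∈ J, e ∉ I ∧ TiedIndep D p (Insert.insert e I) := by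
  classical
  rw [ncard_eq_sum_fiber hIfin, ncard_eq_sum_fiber hJfin] at hlt
  have hne : ∀ i e, e ∈ Prod.mk i ⁻¹' J → e ≠ p := by
    rintro i e he rfl
    exact (hJ.1 i).2 he
  by_cases hT : ∃ j, (D j).Dep (Insert.insert p (Prod.mk j ⁻¹' I))
  · obtain ⟨j, hj⟩ := hT
    have huniq : ∀ k, (D k).Dep (Insert.insert p (Prod.mk k ⁻¹' I)) → k = j :=
      fun k hk ↦ hI.2 k j hk hj
    have aug_j : ∀ e ∈ Prod.mk j ⁻¹' J \ Prod.mk j ⁻¹' I,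
        (D j).Indep (Insert.insert e (Prod.mk j ⁻¹' I)) →
        ∃ e ∈ J, e ∉ I ∧ TiedIndep D p (Insert.insert e I) :=
      fun e he hi ↦ ⟨(j, e), he.1, he.2, hI.insert (hne j e he.1) hi fun k hk hd ↦
        (hk (huniq k hd)).elim⟩
    by_cases hj' : (Prod.mk j ⁻¹' I).ncard < (Prod.mk j ⁻¹' J).ncard
    · obtain ⟨e, he, hi⟩ := (hI.1 j).1.exists_insert_of_ncard_lt (hJ.1 j).1 hj'
      exact aug_j e he hi
    by_cases hB : ∃ i, (Prod.mk i ⁻¹' I).ncard < (Prod.mk i ⁻¹' J).ncard ∧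
      ((Prod.mk i ⁻¹' I).ncard + 1 < (Prod.mk i ⁻¹' J).ncard ∨
        ¬ (D i).Dep (Insert.insert p (Prod.mk i ⁻¹' J)))
    · obtain ⟨i, hi, hi'⟩ := hB
      have hij : i ≠ j := by rintro rfl; exact hj' hi
      obtain ⟨e, he, hie, hd⟩ := (hI.1 i).1.exists_insert_not_dep (hJ.1 i).1 (hI.1 i).2 (hJ.1 i).2
        (fun h ↦ hij (huniq i h)) hi hi'
      exact ⟨(i, e), he.1, he.2, hI.insert (hne i e he.1) hie fun _ _ _ ↦ hd⟩
    -- Now each fibre where J is larger exceeds I by exactly one and spans p in J. As J is tied,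
    -- there is only one such fibre.
    push Not at hB
    obtain ⟨i, -, hi⟩ := Finset.exists_lt_of_sum_lt hlt
    have hij : i ≠ j := by rintro rfl; exact hj' hi
    have hid := (hB i hi).2
    have huniq' : ∀ k, (D k).Dep (Insert.insert p (Prod.mk k ⁻¹' J)) → k = i :=
      fun k hk ↦ hJ.2 k i hk hid
    -- A deficit at j would cancel the surplus of one at i, contradicting |I| < |J|.
    have hjc : (Prod.mk j ⁻¹' J).ncard = (Prod.mk j ⁻¹' I).ncard := by
      by_contra hjc
      have hle : ∀ k ∈ Finset.univ, (Prod.mk k ⁻¹' J).ncard + (if k = j then 1 else 0) ≤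
          (Prod.mk k ⁻¹' I).ncard + (if k = i then 1 else 0) := by
        intro k _
        by_cases hk : (Prod.mk k ⁻¹' I).ncard < (Prod.mk k ⁻¹' J).ncard
        · have hki := huniq' k (hB k hk).2
          subst hki
          have := (hB k hk).1
          simp [hij]; omega
        · by_cases hkj : k = j
          · subst hkj
            simp [hij.symm]; omega
          · simp [hkj]; omega
      have := Finset.sum_le_sum hle
      simp only [Finset.sum_add_distrib, Finset.sum_ite_eq', Finset.mem_univ, if_true] at this
      omega
    -- Fibre j of J does not span p, so adding p gives an independent set larger than fibre j of I.
    -- The augmenting element is not p, which fibre j of I spans.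
    have hpE : p ∈ (D j).E := hj.subset_ground (mem_insert _ _)
    have hJp : (D j).Indep (Insert.insert p (Prod.mk j ⁻¹' J)) := by
      rw [← not_dep_iff (insert_subset hpE (hJ.1 j).1.subset_ground)]
      exact fun h ↦ hij (huniq' j h).symm
    have hJc := ncard_insert_of_notMem (hJ.1 j).2
      ((D j).ground_finite.subset (hJ.1 j).1.subset_ground)
    obtain ⟨e, he, hi⟩ := (hI.1 j).1.exists_insert_of_ncard_lt hJp (by omega)
    refine aug_j e ⟨he.1.resolve_left ?_, he.2⟩ hi
    rintro rfl
    exact hj.not_indep hi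
  · push Not at hT
    obtain ⟨i, -, hi⟩ := Finset.exists_lt_of_sum_lt hlt
    obtain ⟨e, he, hie⟩ := (hI.1 i).1.exists_insert_of_ncard_lt (hJ.1 i).1 hi
    exact ⟨(i, e), he.1, he.2, hI.insert (hne i e he.1) hie fun k _ hk ↦ (hT k hk).elim⟩

/-- The parallel connection at `p` of finitely many finite matroids in which `p` is not a loop,
with `p` deleted. -/
def tiedSum [Fintype ι] (D : ι → Matroid α) (hD : ∀ i, (D i).Finite) (p : α)
    (hp : ∀ i, ¬ (D i).IsLoop p) : Matroid (ι × α) :=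
  have hfin : {x : ι × α | x.2 ∈ (D x.1).E ∧ x.2 ≠ p}.Finite := by
    refine (finite_univ.prod (finite_iUnion fun i ↦ (D i).ground_finite)).subset ?_
    exact fun x hx ↦ ⟨trivial, mem_iUnion.2 ⟨x.1, hx.1⟩⟩
  have hsub : ∀ I : Set (ι × α), TiedIndep D p I →
      I ⊆ {x : ι × α | x.2 ∈ (D x.1).E ∧ x.2 ≠ p} := by
    rintro I hI ⟨i, e⟩ he
    refine ⟨(hI.1 i).1.subset_ground he, ?_⟩
    rintro rfl
    exact (hI.1 i).2 he
  (IndepMatroid.ofFinite hfin (TiedIndep D p)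
    ⟨by simp, fun i j h ↦ by simp [hp] at h⟩
    (fun I J hJ hIJ ↦ ⟨fun i ↦ ⟨(hJ.1 i).1.subset (preimage_mono hIJ),
        fun h ↦ (hJ.1 i).2 (hIJ h)⟩, fun i j hi hj ↦ by
      have aux : ∀ k, (D k).Dep (insert p (Prod.mk k ⁻¹' I)) →
          (D k).Dep (insert p (Prod.mk k ⁻¹' J)) := fun k hk ↦
        hk.superset (insert_subset_insert (preimage_mono hIJ))
          (insert_subset (hk.subset_ground (mem_insert _ _)) (hJ.1 k).1.subset_ground)
      exact hJ.2 i j (aux i hi) (aux j hj)⟩)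
    (fun I J hI hJ hlt ↦ hI.augment hD (hfin.subset (hsub I hI)) (hfin.subset (hsub J hJ)) hJ hlt)
    hsub).matroid

section
variable [Fintype ι] {hD : ∀ i, (D i).Finite} {hp : ∀ i, ¬ (D i).IsLoop p}

lemma tiedSum_finite : (tiedSum D hD p hp).Finite := by
  refine ⟨(finite_univ.prod (finite_iUnion fun i ↦ (D i).ground_finite)).subset ?_⟩
  exact fun x hx ↦ ⟨trivial, mem_iUnion.2 ⟨x.1, hx.1⟩⟩

end

end TiedSum

/-! ### Parallel copies of a component, and the size of circuits. -/

section ParallelCopies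

variable {α : Type u} {N : Matroid α} {p q : α} {n : ℕ}

/-- The elements of `N` that are connected to `p`. -/
def component (N : Matroid α) (p : α) : Set α := {x | N.ConnectedTo p x}

lemma mem_component_self (N : Matroid α) (p : α) : p ∈ N.component p := .inl rfl

lemma component_subset_ground (hp : p ∈ N.E) : N.component p ⊆ N.E := by
  rintro x (rfl | ⟨C, hC, -, hx⟩)
  · exact hp
  · exact hC.subset_ground hx

lemma IsCircuit.subset_component [N.Finite] {C : Set α} (hC : N.IsCircuit C) {x : α} (hx : x ∈ C)
    (hxp : x ∈ N.component p) : C ⊆ N.component p :=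
  fun _ hy ↦ ConnectedTo.trans hxp (.inr ⟨C, hC, hx, hy⟩)

lemma indep_iff_inter_component [N.Finite] {I : Set α} (hI : I ⊆ N.E) (p : α) :
    N.Indep I ↔ N.Indep (I ∩ N.component p) ∧ N.Indep (I \ N.component p) := by
  refine ⟨fun h ↦ ⟨h.subset inter_subset_left, h.subset sdiff_subset⟩, fun ⟨h₁, h₂⟩ ↦ ?_⟩
  rw [indep_iff_forall_subset_not_isCircuit hI]
  intro C hCI hC
  by_cases h : ∃ x ∈ C, x ∈ N.component p
  · obtain ⟨x, hx, hxp⟩ := h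
    exact hC.not_indep (h₁.subset (subset_inter hCI (hC.subset_component hx hxp)))
  · push Not at h
    exact hC.not_indep (h₂.subset fun x hx ↦ ⟨hCI hx, h x hx⟩)

/-- Copies of the component of `p`, one for each element of `Fin n`, and one copy of the rest. -/
def pieces (N : Matroid α) (p : α) (n : ℕ) : Option (Fin n) → Matroid α
  | none => N ↾ (N.E \ N.component p)
  | some _ => N ↾ N.component p

lemma pieces_finite [N.Finite] (hp : p ∈ N.E) (i : Option (Fin n)) : (N.pieces p n i).Finite := by
  cases i with
  | none => exact ⟨N.ground_finite.subset sdiff_subset⟩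
  | some i => exact ⟨N.ground_finite.subset (component_subset_ground hp)⟩

lemma pieces_not_isLoop (hp : N.IsNonloop p) (i : Option (Fin n)) :
    ¬ (N.pieces p n i).IsLoop p := by
  cases i with
  | none => exact fun h ↦ h.mem_ground.2 (mem_component_self N p)
  | some i =>
    intro h
    rcases (restrict_isLoop_iff.1 h).2 with h | h
    · exact h.not_isNonloop hp
    · exact h hp.mem_ground

/-- Copies of the component of `p` in `N` joined in parallel at `p`, with `p` deleted, together with
one copy of the rest of `N`. -/
def parallelCopies (N : Matroid α) [N.Finite] (hp : N.IsNonloop p) (n : ℕ) :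
    Matroid (Option (Fin n) × α) :=
  tiedSum (N.pieces p n) (pieces_finite hp.mem_ground) p (pieces_not_isLoop hp)

variable [N.Finite] {hp : N.IsNonloop p}

/-- Contracting C \ {p, q} in copy j leaves its q parallel to the deleted basepoint. That element
then stands in for p, while copy i and the rest supply the other elements of N. -/
lemma exists_section {C : Set α} (hC : N.IsCircuit C) (hpC : p ∈ C) (hqC : q ∈ C) (hpq : p ≠ q)
    {i j : Fin n} (hij : i ≠ j) :
    ∃ (s : α → Option (Fin n) × α) (Z : Set (Option (Fin n) × α)),
      MapsTo s N.E (N.parallelCopies hp n).E ∧ InjOn s N.E ∧ Disjoint Z (s '' N.E) ∧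
      (∀ I ⊆ N.E, (N.parallelCopies hp n).Indep (s '' I ∪ Z) ↔ N.Indep I) ∧ s p = (some j, q) ∧
      (∀ x ∈ N.component p, x ≠ p → s x = (some i, x)) ∧
      (∀ x, x ∉ N.component p → s x = (none, x)) := by
  classical
  set K := N.component p with hK
  have hpK : p ∈ K := mem_component_self N p
  have hCK : C ⊆ K := hC.subset_component hpC hpK
  have hKE : K ⊆ N.E := component_subset_ground hp.mem_ground
  set s : α → Option (Fin n) × α :=
    fun c ↦ if c = p then (some j, q) else if c ∈ K then (some i, c) else (none, c) with hs
  have hsp : s p = (some j, q) := by simp [hs]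
  have hsK : ∀ x ∈ K, x ≠ p → s x = (some i, x) := fun x hx hxp ↦ by simp [hs, hx, hxp]
  have hsR : ∀ x, x ∉ K → s x = (none, x) := fun x hx ↦ by
    have : x ≠ p := by rintro rfl; exact hx hpK
    simp [hs, hx, this]
  have hcases : ∀ x, x = p ∨ (x ∈ K ∧ x ≠ p) ∨ x ∉ K := fun x ↦ by tauto
  set Z : Set (Option (Fin n) × α) := Prod.mk (some j) '' (C \ {p, q}) with hZ
  refine ⟨s, Z, fun x hx ↦ ?_, fun x hx y hy hxy ↦ ?_, ?_, fun I hI ↦ ?_, hsp, hsK, hsR⟩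
  · rcases hcases x with rfl | ⟨hxK, hxp⟩ | hxK
    · rw [hsp]
      exact ⟨hCK hqC, hpq.symm⟩
    · rw [hsK x hxK hxp]
      exact ⟨hxK, hxp⟩
    · rw [hsR x hxK]
      exact ⟨⟨hx, hxK⟩, by rintro rfl; exact hxK hpK⟩
  · rcases hcases x with rfl | ⟨hxK, hxp⟩ | hxK <;> rcases hcases y with rfl | ⟨hyK, hyp⟩ | hyK
    all_goals simp_all
  · rw [disjoint_left]
    rintro _ ⟨x, hx, rfl⟩ ⟨y, hy, hxy⟩
    rcases hcases y with rfl | ⟨hyK, hyp⟩ | hyK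
    · rw [hsp] at hxy
      exact hx.2 (.inr (congrArg Prod.snd hxy).symm)
    · rw [hsK y hyK hyp] at hxy
      exact hij (Option.some_injective _ (congrArg Prod.fst hxy))
    · rw [hsR y hyK] at hxy
      simp at hxy
  · have hmem : ∀ k x, (k, x) ∈ s '' I ∪ Z ↔ (k = some j ∧ x = q ∧ p ∈ I) ∨
        (k = some i ∧ x ∈ I ∧ x ∈ K ∧ x ≠ p) ∨ (k = none ∧ x ∈ I ∧ x ∉ K) ∨
        (k = some j ∧ x ∈ C ∧ x ≠ p ∧ x ≠ q) := by
      intro k x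
      constructor
      · rintro (⟨y, hy, hyx⟩ | ⟨y, hy, hyx⟩)
        · rcases hcases y with rfl | ⟨hyK, hyp⟩ | hyK
          · rw [hsp] at hyx
            cases hyx
            exact .inl ⟨rfl, rfl, hy⟩
          · rw [hsK y hyK hyp] at hyx
            cases hyx
            exact .inr (.inl ⟨rfl, hy, hyK, hyp⟩)
          · rw [hsR y hyK] at hyx
            cases hyx
            exact .inr (.inr (.inl ⟨rfl, hy, hyK⟩))
        · cases hyx
          exact .inr (.inr (.inr ⟨rfl, hy.1, fun h ↦ hy.2 (.inl h), fun h ↦ hy.2 (.inr h)⟩))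
      · rintro (⟨rfl, rfl, h⟩ | ⟨rfl, h1, h2, h3⟩ | ⟨rfl, h1, h2⟩ | ⟨rfl, h1, h2, h3⟩)
        · exact .inl ⟨p, h, hsp⟩
        · exact .inl ⟨x, h1, hsK x h2 h3⟩
        · exact .inl ⟨x, h1, hsR x h2⟩
        · exact .inr ⟨x, ⟨h1, by simp [h2, h3]⟩, rfl⟩
    have hfn : Prod.mk none ⁻¹' (s '' I ∪ Z) = I \ K := by
      ext x; rw [mem_preimage, hmem]; simp
    have hfi : Prod.mk (some i) ⁻¹' (s '' I ∪ Z) = (I ∩ K) \ {p} := by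
      ext x; rw [mem_preimage, hmem]; simp [hij]; tauto
    have hfj : Prod.mk (some j) ⁻¹' (s '' I ∪ Z) =
        {x | (x = q ∧ p ∈ I) ∨ (x ∈ C ∧ x ≠ p ∧ x ≠ q)} := by
      ext x; rw [mem_preimage, hmem]; simp [hij.symm]
    have hfk : ∀ k, k ≠ i → k ≠ j → Prod.mk (some k) ⁻¹' (s '' I ∪ Z) = ∅ := by
      intro k hki hkj
      ext x; rw [mem_preimage, hmem]; simp [hki, hkj]
    have hjind : N.Indep {x | (x = q ∧ p ∈ I) ∨ (x ∈ C ∧ x ≠ p ∧ x ≠ q)} := by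
      refine hC.ssubset_indep ⟨?_, fun h ↦ ?_⟩
      · rintro x (⟨rfl, -⟩ | h)
        · exact hqC
        · exact h.1
      · rcases h hpC with h | h
        · exact hpq h.1
        · exact h.2.1 rfl
    have hjsub : {x | (x = q ∧ p ∈ I) ∨ (x ∈ C ∧ x ≠ p ∧ x ≠ q)} ⊆ K := by
      rintro x (⟨rfl, -⟩ | h)
      · exact hCK hqC
      · exact hCK h.1
    have hdepn : ∀ S : Set α, ¬ (N.pieces p n none).Dep (insert p S) :=
      fun S h ↦ (h.subset_ground (mem_insert _ _)).2 hpK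
    have hdepk : ∀ (k : Fin n) (S : Set α), S ⊆ K →
        ((N.pieces p n (some k)).Dep (insert p S) ↔ ¬ N.Indep (insert p S)) := by
      intro k S hS
      rw [pieces, restrict_dep_iff, and_iff_left (insert_subset hpK hS)]
    -- Fibre j spans p exactly when it is all of C - p, that is, when the substitute for p is
    -- present.
    have hdepj : p ∈ I ↔
        ¬ N.Indep (insert p {x | (x = q ∧ p ∈ I) ∨ (x ∈ C ∧ x ≠ p ∧ x ≠ q)}) := by
      constructor
      · intro hpI h
        refine hC.not_indep (h.subset fun x hx ↦ ?_)
        by_cases hxp : x = p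
        · exact .inl hxp
        by_cases hxq : x = q
        · exact .inr (.inl ⟨hxq, hpI⟩)
        · exact .inr (.inr ⟨hx, hxp, hxq⟩)
      · intro h
        by_contra hpI
        refine h (hC.ssubset_indep ⟨?_, fun h ↦ ?_⟩)
        · rintro x (rfl | ⟨-, h⟩ | h)
          · exact hpC
          · exact (hpI h).elim
          · exact h.1
        · rcases h hqC with h | h | h
          · exact hpq h.symm
          · exact hpI h.2
          · exact h.2.2 rfl
    rw [indep_iff_inter_component hI p, ← hK]
    constructor
    · rintro ⟨h1, h2⟩
      refine ⟨?_, ?_⟩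
      · have hi := (h1 (some i)).1
        rw [hfi, pieces, restrict_indep_iff] at hi
        by_cases hpI : p ∈ I
        · by_contra hcon
          refine hij (Option.some_injective _ (h2 (some i) (some j) ?_ ?_))
          · rw [hfi, hdepk i _ hi.2, insert_sdiff_singleton, insert_eq_of_mem (show p ∈ I ∩ K from ⟨hpI, hpK⟩)]
            exact hcon
          · rw [hfj, hdepk j _ hjsub]
            exact hdepj.1 hpI
        · refine hi.1.subset fun x hx ↦ ⟨hx, ?_⟩
          rintro rfl
          exact hpI hx.1
      · have hi := (h1 none).1
        rw [hfn, pieces, restrict_indep_iff] at hi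
        exact hi.1
    · rintro ⟨h1, h2⟩
      have hdep : ∀ k, (N.pieces p n k).Dep (insert p (Prod.mk k ⁻¹' (s '' I ∪ Z))) →
          k = some j ∨ (k = some i ∧ p ∉ I) := by
        rintro (_ | k) hk
        · exact (hdepn _ hk).elim
        by_cases hkj : k = j
        · exact .inl (by rw [hkj])
        by_cases hki : k = i
        · subst hki
          refine .inr ⟨rfl, fun hpI ↦ ?_⟩
          rw [hfi, hdepk k _ (sdiff_subset.trans inter_subset_right), insert_sdiff_singleton,
            insert_eq_of_mem (show p ∈ I ∩ K from ⟨hpI, hpK⟩)] at hk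
          exact hk h1
        · rw [hfk k hki hkj, hdepk k _ (empty_subset _)] at hk
          exact (hk (by simpa using hp)).elim
      refine ⟨?_, fun k l hk hl ↦ ?_⟩
      · rintro (_ | k)
        · rw [hfn, pieces, restrict_indep_iff]
          exact ⟨⟨h2, fun x hx ↦ ⟨hI hx.1, hx.2⟩⟩, fun h ↦ h.2 hpK⟩
        rw [pieces, restrict_indep_iff]
        by_cases hkj : k = j
        · subst hkj
          rw [hfj]
          refine ⟨⟨hjind, hjsub⟩, ?_⟩
          rintro (h | h)
          · exact hpq h.1
          · exact h.2.1 rfl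
        by_cases hki : k = i
        · subst hki
          rw [hfi]
          exact ⟨⟨h1.subset sdiff_subset, sdiff_subset.trans inter_subset_right⟩, fun h ↦ h.2 rfl⟩
        · rw [hfk k hki hkj]
          simp
      · have hj : (N.pieces p n (some j)).Dep (insert p (Prod.mk (some j) ⁻¹' (s '' I ∪ Z))) →
            p ∈ I := by
          rw [hfj, hdepk j _ hjsub]
          exact hdepj.2
        rcases hdep k hk with rfl | ⟨rfl, hpI⟩ <;> rcases hdep l hl with rfl | ⟨rfl, hpI'⟩
        · rfl
        · exact (hpI' (hj hk)).elim
        · exact (hpI (hj hl)).elim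
        · rfl

/-- For elements a and b in different copies, use a circuit through p and b, so that b plays p and a
plays itself. Any other pair lies in one copy together with the rest, and any second copy can supply
p. -/
lemma parallelCopies_minorConnected (hn : 2 ≤ n) {C : Set α} (hC : N.IsCircuit C) (hpC : p ∈ C)
    (hqC : q ∈ C) (hpq : p ≠ q) : N.MinorConnected (N.parallelCopies hp n) := by
  have hqK : q ∈ N.component p := .inr ⟨C, hC, hpC, hqC⟩
  have hKE := component_subset_ground hp.mem_ground
  refine minorConnected_of_forall ⟨(some ⟨0, by omega⟩, q), ⟨hqK, hpq.symm⟩,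
    (some ⟨1, by omega⟩, q), ⟨hqK, hpq.symm⟩, by simp⟩ ?_
  have key : ∀ (i : Fin n) (k l : Option (Fin n)) (a b : α),
      (k, a) ∈ (N.parallelCopies hp n).E → (l, b) ∈ (N.parallelCopies hp n).E →
      (k = none ∨ k = some i) → (l = none ∨ l = some i) →
      ∃ (s : α → Option (Fin n) × α) (Z : Set (Option (Fin n) × α)),
        MapsTo s N.E (N.parallelCopies hp n).E ∧ InjOn s N.E ∧ Disjoint Z (s '' N.E) ∧
        (∀ I ⊆ N.E, (N.parallelCopies hp n).Indep (s '' I ∪ Z) ↔ N.Indep I) ∧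
        (k, a) ∈ s '' N.E ∧ (l, b) ∈ s '' N.E := by
    intro i k l a b ha hb hk hl
    have : Nontrivial (Fin n) := Fin.nontrivial_iff_two_le.2 hn
    obtain ⟨j, hj⟩ := exists_ne i
    obtain ⟨s, Z, h1, h2, h3, h4, -, h6, h7⟩ := exists_section (hp := hp) hC hpC hqC hpq hj.symm
    have hmem : ∀ k a, (k, a) ∈ (N.parallelCopies hp n).E → (k = none ∨ k = some i) →
        (k, a) ∈ s '' N.E := by
      rintro k a ha (rfl | rfl)
      · exact ⟨a, ha.1.1, h7 a ha.1.2⟩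
      · exact ⟨a, hKE ha.1, h6 a ha.1 ha.2⟩
    exact ⟨s, Z, h1, h2, h3, h4, hmem k a ha hk, hmem l b hb hl⟩
  rintro ⟨_ | i, a⟩ he ⟨_ | j, b⟩ hf -
  · exact key ⟨0, by omega⟩ _ _ _ _ he hf (.inl rfl) (.inl rfl)
  · exact key j _ _ _ _ he hf (.inl rfl) (.inr rfl)
  · exact key i _ _ _ _ he hf (.inr rfl) (.inl rfl)
  · by_cases hij : i = j
    · subst hij
      exact key i _ _ _ _ he hf (.inr rfl) (.inr rfl)
    · obtain ⟨hbK, hbp⟩ : b ∈ N.component p ∧ b ≠ p := hf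
      obtain ⟨C', hC', hpC', hbC'⟩ := hbK.resolve_left hbp.symm
      obtain ⟨s, Z, h1, h2, h3, h4, h5, h6, -⟩ :=
        exists_section (hp := hp) hC' hpC' hbC' hbp.symm hij
      exact ⟨s, Z, h1, h2, h3, h4, ⟨a, hKE he.1, h6 a he.1 he.2⟩, ⟨p, hp.mem_ground, h5⟩⟩

/-- The copies of q lie in distinct fibres, so a dependence among them can only come from two fibres
that both span p. Two elements of C already account for that, hence are the whole of C. -/
lemma InductiveProperty.isCircuit_eq_pair (h : N.InductiveProperty) {C : Set α}
    (hC : N.IsCircuit C) (hpC : p ∈ C) (hqC : q ∈ C) (hpq : p ≠ q) : C = {p, q} := by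
  classical
  have hp : N.IsNonloop p := hC.isNonloop_of_mem ⟨p, hpC, q, hqC, hpq⟩ hpC
  set n := N.E.ncard with hn
  have hn2 : 2 ≤ n := by
    rw [hn, ← ncard_pair hpq]
    exact ncard_le_ncard (pair_subset (hC.subset_ground hpC) (hC.subset_ground hqC)) N.ground_finite
  have hc := parallelCopies_minorConnected (hp := hp) hn2 hC hpC hqC hpq
  have : (N.parallelCopies hp n).Finite := tiedSum_finite
  set X : Set (Option (Fin n) × α) := range fun i : Fin n ↦ (some i, q) with hX
  have hXE : X ⊆ (N.parallelCopies hp n).E := by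
    rintro _ ⟨i, rfl⟩
    exact ⟨.inr ⟨C, hC, hpC, hqC⟩, hpq.symm⟩
  obtain ⟨s, Z, hs, hZE, hZX, hZ, hI⟩ := h.exists_bijOn hc (by omega) hXE (by
    rw [hX, ← image_univ, ncard_image_of_injective _ fun i j hij ↦
      Option.some_injective _ (congrArg Prod.fst hij)]
    simp [hn])
  have hsnd : ∀ a ∈ N.E, (s a).2 = q := by
    intro a ha
    obtain ⟨i, hi⟩ := hs.mapsTo ha
    rw [← hi]
  have hsub : ∀ {c} {S : Set α}, c ∈ S → ({c} : Set α) ⊆ S := fun h ↦ singleton_subset_iff.2 h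
  -- A fibre receives at most one element of C; if it receives none, p is an arbitrary choice.
  have hfib : ∀ i, ∃ c ∈ C, Prod.mk i ⁻¹' (s '' C ∪ Z) ⊆ Prod.mk i ⁻¹' (s '' {c} ∪ Z) := by
    intro i
    by_cases hi : ∃ c ∈ C, s c = (i, q)
    · obtain ⟨c, hc, hci⟩ := hi
      refine ⟨c, hc, ?_⟩
      rintro x (⟨y, hy, hyx⟩ | hx)
      · have := hsnd y (hC.subset_ground hy)
        rw [hyx] at this
        refine .inl ⟨c, rfl, ?_⟩
        rw [hci, ← this]
      · exact .inr hx
    · refine ⟨p, hpC, ?_⟩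
      rintro x (⟨y, hy, hyx⟩ | hx)
      · have := hsnd y (hC.subset_ground hy)
        refine (hi ⟨y, hy, ?_⟩).elim
        rw [hyx] at this ⊢
        exact congrArg _ this
      · exact .inr hx
  have hnot : ¬ (N.parallelCopies hp n).Indep (s '' C ∪ Z) := by
    rw [← hI C hC.subset_ground]
    exact hC.not_indep
  have hfi : ∀ i, (N.pieces p n i).Indep (Prod.mk i ⁻¹' (s '' C ∪ Z)) ∧
      p ∉ Prod.mk i ⁻¹' (s '' C ∪ Z) := by
    intro i
    obtain ⟨c, hc, hci⟩ := hfib i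
    have h1 : N.Indep {c} :=
      (hC.isNonloop_of_mem ⟨p, hpC, q, hqC, hpq⟩ hc).indep
    rw [hI _ (hsub (hC.subset_ground hc))] at h1
    exact ⟨(h1.1 i).1.subset hci, fun h ↦ (h1.1 i).2 (hci h)⟩
  have hex : ∃ i j, (N.pieces p n i).Dep (insert p (Prod.mk i ⁻¹' (s '' C ∪ Z))) ∧
      (N.pieces p n j).Dep (insert p (Prod.mk j ⁻¹' (s '' C ∪ Z))) ∧ i ≠ j := by
    by_contra! hcon
    exact hnot ⟨hfi, hcon⟩
  obtain ⟨i, j, hi, hj, hij⟩ := hex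
  obtain ⟨c, hc, hci⟩ := hfib i
  obtain ⟨d, hd, hdj⟩ := hfib j
  have hcd : ¬ N.Indep {c, d} := by
    rw [hI _ (pair_subset (hC.subset_ground hc) (hC.subset_ground hd))]
    intro hind
    refine hij (hind.2 i j (hi.superset (insert_subset_insert (hci.trans ?_)) ?_)
      (hj.superset (insert_subset_insert (hdj.trans ?_)) ?_))
    · exact preimage_mono (union_subset_union_left _ (image_mono (by simp)))
    · exact insert_subset (hi.subset_ground (mem_insert _ _)) (hind.1 i).1.subset_ground
    · exact preimage_mono (union_subset_union_left _ (image_mono (by simp)))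
    · exact insert_subset (hj.subset_ground (mem_insert _ _)) (hind.1 j).1.subset_ground
  have hCcd := hC.eq_of_not_indep_subset hcd (pair_subset hc hd)
  rw [← hCcd] at hpC hqC ⊢
  rcases hpC with rfl | rfl <;> rcases hqC with rfl | rfl
  · exact (hpq rfl).elim
  · rfl
  · exact pair_comm _ _
  · exact (hpq rfl).elim

end ParallelCopies

/-! ### Assembling the classification. -/

section Main

variable {α : Type u} {N : Matroid α} {p q : α}

lemma IsCircuit.indep_insert_of_pair (hC : N.IsCircuit {p, q}) {I : Set α} (hqI : q ∉ I)
    (hpI : p ∉ I) (hI : N.Indep (insert p I)) (hqE : q ∈ N.E) : N.Indep (insert q I) := by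
  have hIE : I ⊆ N.E := (subset_insert _ _).trans hI.subset_ground
  rw [indep_iff_forall_subset_not_isCircuit (insert_subset hqE hIE)]
  intro C' hC'I hC'
  by_cases hpq : p = q
  · subst hpq
    exact hC'.not_indep (hI.subset hC'I)
  have hpC' : p ∉ C' := fun h ↦ (hC'I h).elim hpq hpI
  obtain ⟨C'', hs, hC''⟩ := hC'.elimination hC (fun h ↦ hpC' (h ▸ .inl rfl)) q
  refine hC''.not_indep (hI.subset fun x hx ↦ ?_)
  obtain ⟨hx1 | rfl | hx1, hx2⟩ := hs hx
  · exact .inr ((hC'I hx1).resolve_left hx2)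
  · exact .inl rfl
  · exact (hx2 hx1).elim

/-- A matroid with the inductive property and with a circuit with more than one element has
rank one and no loops. -/
lemma InductiveProperty.of_nontrivial_isCircuit [N.Finite] (h : N.InductiveProperty) {C : Set α}
    (hC : N.IsCircuit C) (hnt : C.Nontrivial) :
    (∀ a ∈ N.E, ∀ b ∈ N.E, a ≠ b → ¬ N.Indep {a, b}) ∧ ∀ a ∈ N.E, N.Indep {a} := by
  obtain ⟨p, hp, q, hq, hpq⟩ := id hnt
  have hpE := hC.subset_ground hp
  have hqE := hC.subset_ground hq
  have hpair := h.isCircuit_eq_pair hC hp hq hpq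
  have hpi : N.Indep {p} := (hC.isNonloop_of_mem hnt hp).indep
  rw [hpair] at hC
  obtain ⟨h1, h2⟩ := h.not_indep_pair hpE hqE hpq hC.not_indep (by
    intro I hI
    have hpI : p ∉ I := fun h ↦ (hI h).2 (.inl rfl)
    have hqI : q ∉ I := fun h ↦ (hI h).2 (.inr rfl)
    exact ⟨fun hi ↦ hC.indep_insert_of_pair hqI hpI hi hqE,
      fun hi ↦ (pair_comm p q ▸ hC).indep_insert_of_pair hpI hqI hi hpE⟩)
  exact ⟨h1, fun a ha ↦ h2 p hpE a ha hpi⟩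

/-- A larger circuit makes N loopless of rank one, so its dual has a nontrivial circuit but also an
independent pair, contrary to the same result for the dual. -/
lemma InductiveProperty.isCircuit_subsingleton [N.Finite] (h : N.InductiveProperty)
    (hcard : 3 ≤ N.E.ncard) {C : Set α} (hC : N.IsCircuit C) : C.Subsingleton := by
  by_contra hnt
  rw [not_subsingleton_iff] at hnt
  obtain ⟨hpair, hsing⟩ := h.of_nontrivial_isCircuit hC hnt
  obtain ⟨a, b, c, ha, hb, hc, hab, hac, hbc⟩ := (two_lt_ncard_iff N.ground_finite).1 hcard
  have hbase : ∀ x ∈ N.E, N.IsBase {x} := by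
    intro x hx
    rw [isBase_iff_maximal_indep, maximal_subset_iff]
    refine ⟨hsing x hx, fun J hJ hxJ ↦ hxJ.antisymm fun y hy ↦ ?_⟩
    by_contra hyx
    exact hpair x hx y (hJ.subset_ground hy) (Ne.symm hyx)
      (hJ.subset (pair_subset (hxJ rfl) hy))
  have hbc' : N✶.Indep {b, c} := by
    rw [dual_indep_iff_exists (pair_subset hb hc)]
    exact ⟨{a}, hbase a ha, by simp [hab, hac]⟩
  have hdep : N✶.Dep N.E := by
    refine (not_indep_iff (M := N✶) (dual_ground (M := N)).symm.subset).1 ?_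
    rw [dual_indep_iff_exists subset_rfl]
    rintro ⟨B, hB, hdj⟩
    have hB0 : B = ∅ := hdj.symm.eq_bot_of_le hB.subset_ground
    exact (singleton_ne_empty a) (hB.eq_of_subset_isBase (hbase a ha) (by simp [hB0]) ▸ hB0)
  obtain ⟨K, hKE, hK⟩ := hdep.exists_isCircuit_subset
  have hKnt : K.Nontrivial := by
    rw [← not_subsingleton_iff]
    intro hKs
    obtain ⟨x, rfl⟩ := hKs.eq_empty_or_singleton.resolve_left hK.nonempty.ne_empty
    obtain ⟨y, hy, hyx⟩ : ∃ y ∈ N.E, y ≠ x := by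
      by_cases hax : a = x
      · exact ⟨b, hb, fun h ↦ hab (hax.trans h.symm)⟩
      · exact ⟨a, ha, hax⟩
    refine hK.not_indep ?_
    rw [dual_indep_iff_exists hKE]
    exact ⟨{y}, hbase y hy, by simpa using hyx.symm⟩
  exact (h.dual.of_nontrivial_isCircuit hK hKnt).1 b hb c hc hbc hbc'

lemma InductiveProperty.loops_subsingleton [N.Finite] (h : N.InductiveProperty)
    (hcard : 3 ≤ N.E.ncard) : N.loops.Subsingleton := by
  intro a ha b hb
  by_contra hab
  have ha' : N.IsLoop a := ha
  have hb' : N.IsLoop b := hb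
  obtain ⟨-, h2⟩ := h.not_indep_pair ha'.mem_ground hb'.mem_ground hab
    (ha'.not_indep_of_mem (by simp)) fun I _ ↦
      iff_of_false (ha'.not_indep_of_mem (by simp)) (hb'.not_indep_of_mem (by simp))
  obtain ⟨e, he, hei⟩ := h.exists_indep_singleton hcard
  exact ha'.not_indep_of_mem (mem_singleton a) (h2 e he a ha'.mem_ground hei)

/-- With three or more elements, each is a loop or a coloop, and there is at most one of each. -/
lemma InductiveProperty.ncard_le_two [N.Finite] (h : N.InductiveProperty) : N.E.ncard ≤ 2 := by
  by_contra! hcard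
  have hE : N.E ⊆ N.loops ∪ N✶.loops := by
    intro x hx
    by_cases hxc : N.IsColoop x
    · exact .inr hxc
    obtain ⟨C, hC, hxC⟩ := exists_mem_isCircuit_of_not_isColoop hx hxc
    have := (h.isCircuit_subsingleton hcard hC).eq_singleton_of_mem hxC
    exact .inl (singleton_isCircuit.1 (this ▸ hC))
  have hf1 : Finite N.loops := N.ground_finite.subset N.loops_subset_ground
  have hf2 : Finite N✶.loops := N.ground_finite.subset N✶.loops_subset_ground
  have h1 := ncard_le_one_iff_subsingleton.2 (h.loops_subsingleton hcard)
  have h2 := ncard_le_one_iff_subsingleton.2 (h.dual.loops_subsingleton hcard)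
  have h3 := ncard_le_ncard hE (toFinite _)
  have h4 := ncard_union_le N.loops N✶.loops
  omega

lemma InductiveProperty.isomorphic_uniform [N.Finite] (h : N.InductiveProperty)
    (hcard : 2 ≤ N.E.ncard) : N.Isomorphic (uniform 1 2) ∨ N.Isomorphic (uniform 0 2) ∨
      N.Isomorphic (uniform 2 2) := by
  have hc : N.E.ncard = 2 := le_antisymm h.ncard_le_two hcard
  obtain ⟨a, b, hab, hE⟩ := ncard_eq_two.1 hc
  have hsub : ∀ I ⊆ N.E, I = ∅ ∨ I = {a} ∨ I = {b} ∨ I = {a, b} := fun I hI ↦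
    subset_pair_iff_eq.1 (hE ▸ hI)
  have hiso : ∀ r, (N.Indep {a} ↔ 1 ≤ r) → (N.Indep {b} ↔ 1 ≤ r) → (N.Indep {a, b} ↔ 2 ≤ r) →
      N.Isomorphic (uniform r 2) := by
    intro r h1 h2 h3
    refine (isomorphic_uniform_iff (by simp)).2 ⟨hc, fun I hI ↦ ?_⟩
    rcases hsub I hI with rfl | rfl | rfl | rfl
    · simp
    · rw [h1, ncard_singleton]
    · rw [h2, ncard_singleton]
    · rw [h3, ncard_pair hab]
  have hda : N.Indep {a, b} → N.Indep {a} := fun h ↦ h.subset (by simp)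
  have hdb : N.Indep {a, b} → N.Indep {b} := fun h ↦ h.subset (by simp)
  by_cases hi : N.Indep {a, b}
  · exact .inr (.inr (hiso 2 (by simp [hda hi]) (by simp [hdb hi]) (by simp [hi])))
  by_cases ha : N.Indep {a}
  · have hb : N.Indep {b} := by
      by_contra hb
      exact h.isLoop_of_isLoop (hE.trans (pair_comm a b)) hab.symm hb ha
    exact .inl (hiso 1 (by simp [ha]) (by simp [hb]) (by simp [hi]))
  · have hb := h.isLoop_of_isLoop hE hab ha
    exact .inr (.inl (hiso 0 (by simp [ha]) (by simp [hb]) (by simp [hi])))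

lemma IsConnected.rank_eq_one {r : ℕ} (hN : N.IsConnected) (h : N.Isomorphic (uniform r 2)) :
    r = 1 := by
  obtain ⟨hc, hI⟩ := (isomorphic_uniform_iff (by simp)).1 h
  obtain ⟨a, b, hab, hE⟩ := ncard_eq_two.1 hc
  have ha : a ∈ N.E := by simp [hE]
  have hb : b ∈ N.E := by simp [hE]
  obtain ⟨C, hC, haC, hbC⟩ := hN a ha b hb hab
  have h1 : N.Indep {a} := (hC.isNonloop_of_mem ⟨a, haC, b, hbC, hab⟩ haC).indep
  have h2 : ¬ N.Indep {a, b} := fun h ↦ hC.not_indep (h.subset (hE ▸ hC.subset_ground))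
  rw [hI _ (by simpa), ncard_singleton] at h1
  rw [hI _ (pair_subset ha hb), ncard_pair hab] at h2
  omega

end Main

end Matroid

theorem theorem1p1 {α : Type*} (N : Matroid α) (hfin : N.Finite) (hcard : 2 ≤ N.E.ncard) :
    (N.InductiveProperty →
      N.Isomorphic (Matroid.uniform 1 2) ∨ N.Isomorphic (Matroid.uniform 0 2) ∨
        N.Isomorphic (Matroid.uniform 2 2)) ∧
    (N.IsConnected → (N.InductiveProperty ↔ N.Isomorphic (Matroid.uniform 1 2))) := by
  refine ⟨fun h ↦ h.isomorphic_uniform hcard, fun hN ↦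
    ⟨fun h ↦ ?_, Matroid.inductiveProperty_of_isomorphic_uniform_one_two⟩⟩
  rcases h.isomorphic_uniform hcard with h | h | h
  · exact h
  · exact absurd (hN.rank_eq_one h) (by simp)
  · exact absurd (hN.rank_eq_one h) (by simp)
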